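/- **Setting.** There are $n$ additive, quasi-linear, risk-neutral buyers and $2$ items. Let $\mathcal D$ be an arbitrary (possibly correlated across buyers and items) probability distribution of value profiles $v=(v_{ij})_{1\le i\le n,\ 1\le j\le 2}$ with all $v_{ij}\ge 0$, and let $\delta>0$. In the *Square-Shift model*, $\hat{\mathcal D}$ is the law of $\hat v$ with $\hat v_{ij}=v_{ij}+\varepsilon_{ij}\max\{v_{i1},v_{i2}\}$, where $v\sim\mathcal D$ and the $\varepsilon_{ij}$ are uniform on $[0,\delta]$, independent of each other and of $v$. A (direct, randomized) mechanism consists of measurable allocation probabilities $x_{ij}(v)\ge 0$ with $\sum_i x_{ij}(v)\le 1$ for each item $j$, and measurable real payments $p_i(v)$, for all $v\in([0,\infty)^2)^n$; buyer $i$ with values $t$ has utility $\sum_j t_j x_{ij}-p_i$. Its revenue is $\sum_i \mathbb E_{\hat v\sim\hat{\mathcal D}}[p_i(\hat v)]\in[-\infty,\infty]$ (mechanisms for which some $\mathbb E[p_i]$ is undefined are excluded). * $\mathrm{DRev}(\hat{\mathcal D})$ is the supremum of the revenue over mechanisms that are dominant-strategy incentive compatible (truthful reporting is optimal for each buyer at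 every profile of reports of the others) and ex-post individually rational (truthful reporting gives utility $\ge 0$ at every profile). * For $\hat{\mathcal D}$ independent across buyers, $\mathrm{BICRev}(\hat{\mathcal D})$ is the supremum of the revenue over mechanisms in which the expected payment of each report of each buyer exists and that are Bayesian incentive compatible and interim individually rational (truthful reporting maximizes each type's expected utility, and makes it $\ge 0$, in expectation over the truthful reports of the others). * $\mathrm{RonenRev}(\hat{\mathcal D})$ is the revenue of Ronen's auction for the grand bundle. Let $s_i=v_{i1}+v_{i2}$ and $w_i=\max_{j\ne i}s_j$ (with $w_i=0$ if $n=1$). Only a highest bidder $i$ (one with $s_i\ge w_i$; ties broken by index) may win; she is offered both items at the price $\max\{w_i,\rho_i(v_{-i})\}$, where the reserve $\rho_i$ depends on the reported value vectors $v_{-i}=(v_j)_{j\neq i}$ of the other buyers, and she buys if and only if $s_i$ is at least this price. The reserves are chosen optimally for $\hat{\mathcal D}$: $\mathrm{RonenRev}(\hat{\mathcal D})$ is the supremum of the revenue over all measurable $\rho_1,\dots,\rho_n$. **Theorem.** For all $n$, $\delta>0$ and $\mathcal D$ as above, $$\mathrm{DRev}(\hat{\mathcal D})\;\le\;\frac{9\sqrt2\,(1+\delta)^3\log(1+\delta)}{\delta^2}\;\mathrm{RonenRev}(\hat{\mathcal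 D}).$$ If moreover $\mathcal D$ is independent across buyers (the vectors $(v_{i1},v_{i2})$, $1\le i\le n$, are independent; the two values of one buyer may be correlated), then also $$\mathrm{BICRev}(\hat{\mathcal D})\;\le\;\frac{9\sqrt2\,(1+\delta)^3\log(1+\delta)}{\delta^2}\;\mathrm{RonenRev}(\hat{\mathcal D}).$$ The factor $\frac{9\sqrt2(1+\delta)^3\log(1+\delta)}{\delta^2}$ is $O(1/\delta)$ as $\delta\to0^+$, so both bounds are $O(\mathrm{RonenRev}(\hat{\mathcal D})/\delta)$, uniformly in $n$ and $\mathcal D$. (All quantities may be $+\infty$.) -/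

import Mathlib

open MeasureTheory ProbabilityTheory Filter Topology Asymptotics

namespace SmoothedAuction

/-- A valuation profile of `n` additive buyers for two items: `v i j` is the value of buyer `i`
for item `j`. The type space of a buyer is `[0, ∞)²`, singled out by `0 ≤ t`. -/
abbrev Profile (n : ℕ) : Type := Fin n → Fin 2 → ℝ

/-! ### The Square-Shift model -/

/-- Buyer `i`'s value for item `j` becomes `v i j + ε i j * max (v i 0) (v i 1)`. -/
def shift {n : ℕ} (v ε : Profile n) : Profile n :=
  fun i j => v i j + ε i j * max (v i 0) (v i 1)

/-- The perturbations `ε i j`: independent and uniform on `[0, δ]`. -/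
noncomputable def noise (n : ℕ) (δ : ℝ) : Measure (Profile n) :=
  Measure.pi fun _ : Fin n => Measure.pi fun _ : Fin 2 => volume[|Set.Icc 0 δ]

/-- The smoothed distribution: the law of `shift v ε`, where `v` has law `D` and `ε` is
independent of `v`. -/
noncomputable def squareShift {n : ℕ} (δ : ℝ) (D : Measure (Profile n)) : Measure (Profile n) :=
  (D.prod (noise n δ)).map fun p => shift p.1 p.2

/-! ### Revenue -/

/-- The expectation `E[f⁺] - E[f⁻]` of `f` with values in `[-∞, ∞]`; if both parts are infinite,
it is `⊥` by the convention `⊤ - ⊤ = ⊥` of `EReal`, so that a payment without an expectation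
never contributes to an optimal revenue. -/
noncomputable def expectation {n : ℕ} (D : Measure (Profile n)) (f : Profile n → ℝ) : EReal :=
  ((∫⁻ v, ENNReal.ofReal (f v) ∂D : ENNReal) : EReal) -
    ((∫⁻ v, ENNReal.ofReal (-f v) ∂D : ENNReal) : EReal)

/-- The expected revenue: the sum of the expected payments of the buyers, when `pay v i` is the
payment of buyer `i` under the profile `v`. -/
noncomputable def revenue {n : ℕ} (D : Measure (Profile n)) (pay : Profile n → Fin n → ℝ) :
    EReal :=
  ∑ i, expectation D fun v => pay v i

/-! ### Mechanisms -/

/-- A direct (possibly randomized) mechanism: on the reports `v`, buyer `i` receives item `j` with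
probability `alloc v i j` and makes the (expected) payment `pay v i`; each item is given to at most
one buyer. Payments may be negative. -/
structure Mechanism (n : ℕ) where
  alloc : Profile n → Fin n → Fin 2 → ℝ
  pay : Profile n → Fin n → ℝ
  measurable_alloc : Measurable alloc
  measurable_pay : Measurable pay
  alloc_nonneg : ∀ v, 0 ≤ v → ∀ i j, 0 ≤ alloc v i j
  alloc_feasible : ∀ v, 0 ≤ v → ∀ j, ∑ i, alloc v i j ≤ 1

namespace Mechanism

variable {n : ℕ} (M : Mechanism n)

/-- The expected (quasi-linear) utility of buyer `i` with true values `t` when the reports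
are `v`. -/
noncomputable def utility (i : Fin n) (t : Fin 2 → ℝ) (v : Profile n) : ℝ :=
  ∑ j, t j * M.alloc v i j - M.pay v i

/-- Dominant-strategy incentive compatibility: reporting the truth is optimal whatever the reports
of the other buyers. -/
def DSIC : Prop :=
  ∀ v, 0 ≤ v → ∀ (i : Fin n) (b : Fin 2 → ℝ), 0 ≤ b →
    M.utility i (v i) (Function.update v i b) ≤ M.utility i (v i) v

/-- Ex-post individual rationality. -/
def ExPostIR : Prop :=
  ∀ v, 0 ≤ v → ∀ i : Fin n, 0 ≤ M.utility i (v i) v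

/-- The interim utility of buyer `i` with true values `t` who reports `b`, the other buyers
reporting truthfully. The distribution `D` is understood to be independent across buyers, so that
the values of the other buyers have the same law whatever `t` is; averaging over all of `D` with
the `i`-th entry replaced by `b` is then averaging over the values of the other buyers. -/
noncomputable def interimUtility (D : Measure (Profile n)) (i : Fin n) (t b : Fin 2 → ℝ) : ℝ :=
  ∫ v, M.utility i t (Function.update v i b) ∂D

/-- Bayesian incentive compatibility for a distribution `D` that is independent across buyers: the
interim payment of every report exists, and reporting the truth maximizes the interim utility. -/
def BIC (D : Measure (Profile n)) : Prop :=
  (∀ (i : Fin n) (b : Fin 2 → ℝ), 0 ≤ b →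
    Integrable (fun v => M.pay (Function.update v i b) i) D) ∧
  ∀ (i : Fin n) (t b : Fin 2 → ℝ), 0 ≤ t → 0 ≤ b →
    M.interimUtility D i t b ≤ M.interimUtility D i t t

/-- Interim individual rationality. -/
def InterimIR (D : Measure (Profile n)) : Prop :=
  ∀ (i : Fin n) (t : Fin 2 → ℝ), 0 ≤ t → 0 ≤ M.interimUtility D i t t

end Mechanism

/-- The optimal revenue of a DSIC, ex-post individually rational mechanism. -/
noncomputable def DRev {n : ℕ} (D : Measure (Profile n)) : EReal :=
  ⨆ M : {M : Mechanism n // M.DSIC ∧ M.ExPostIR}, revenue D M.1.pay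

/-- The optimal revenue of a BIC, interim individually rational mechanism, for a distribution `D`
that is independent across buyers. -/
noncomputable def BICRev {n : ℕ} (D : Measure (Profile n)) : EReal :=
  ⨆ M : {M : Mechanism n // M.BIC D ∧ M.InterimIR D}, revenue D M.1.pay

/-! ### Ronen's auction for the grand bundle -/

/-- Buyer `i`'s value for the grand bundle. -/
def bundle {n : ℕ} (v : Profile n) (i : Fin n) : ℝ := ∑ j, v i j

/-- The highest value for the grand bundle among the buyers other than `i` (`0` if there is no
other buyer). -/
noncomputable def rivalBid {n : ℕ} (v : Profile n) (i : Fin n) : ℝ :=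
  ⨆ j : {j : Fin n // j ≠ i}, bundle v j.1

/-- A measurable rule that sets a reserve price for each buyer `i` as a function of the reports of
the other buyers. -/
structure ReserveRule (n : ℕ) where
  reserve : (i : Fin n) → ({j : Fin n // j ≠ i} → Fin 2 → ℝ) → ℝ
  measurable_reserve : ∀ i, Measurable (reserve i)

namespace ReserveRule

variable {n : ℕ} (ρ : ReserveRule n)

/-- The price of the grand bundle for buyer `i`: the maximum of the highest competing bid and
of the reserve. -/
noncomputable def price (v : Profile n) (i : Fin n) : ℝ :=
  max (rivalBid v i) (ρ.reserve i fun j => v j.1)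

/-- The payments of the second-price auction for the grand bundle with reserves `ρ`: the highest
bidder (the first one, in case of ties) buys the grand bundle if her value for it is at least her
price; nobody else buys anything. -/
noncomputable def pay (v : Profile n) (i : Fin n) : ℝ :=
  if (∀ j, bundle v j ≤ bundle v i) ∧ (∀ j < i, bundle v j < bundle v i) ∧
      ρ.price v i ≤ bundle v i
  then ρ.price v i else 0

end ReserveRule

/-- The revenue of Ronen's auction for the grand bundle, that is, of the second-price auction for
the grand bundle in which the reserve of each buyer is chosen optimally for `D` given the reports of
the other buyers. A supremum, because an optimal reserve need not exist. -/
noncomputable def RonenRev {n : ℕ} (D : Measure (Profile n)) : EReal :=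
  ⨆ ρ : ReserveRule n, revenue D ρ.pay

end SmoothedAuction

namespace SmoothedAuction

/-! Single out one buyer and cut the quadrant of her perturbed values into rays from the origin,
indexed by the more valuable item `s` and the ratio `t` of the smaller coordinate to the larger
coordinate `x`. Keeping only the incentive constraints between types on one ray leaves a
single-parameter problem in `x`, where Myerson's theory applies even though the two-item problem has
no such theory. Let `w` be the highest competing bid for the bundle; on the ray the bundle is worth
`x * (1 + t)`. Types with bundle value below `w` are charged at most the value they receive; the
rest yields at most `1 + t` times the best revenue of a price above `w / (1 + t)` on that ray
(`lintegral_payment_le`).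

Knowing the ray would let a seller tailor the price to it, and smoothing limits this advantage. A
value vector with maximum `m` is spread uniformly over a square of side `δ * m`, so it puts density
at most `(1 + δ) / δ` in total on any one ray, and only where `m ≤ x ≤ (1 + δ) * m`
(`rayMeasure_Ici_le`). A high price on a ray can therefore be replaced by a price for the bundle,
lower by a factor `2 * (1 + δ)`, that does not depend on the ray. A price too close to `w` for this
earns little more than `w` per sale, and the mass above `w`, integrated over the rays, is again the
revenue of bundle prices just above `w`. This is `lintegral_buyer_payment_le`, with constant `6 * (1
+ δ) ^ 2 / δ`.

Summed over buyers, the posted prices above the competing bids are the reserves of one Ronen auction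
(`sum_lintegral_postedRevenue_le`). The values received below the competing bids total at most twice
the second-highest bid, since there are two items, and the auction without reserves already collects
that bid (`sum_value_of_lower_bidders_le`). The resulting factor `2 + 6 * (1 + δ) ^ 2 / δ` is below
the stated one.

Both halves of the theorem share this argument. In the Bayesian case the constraints hold only on
average over the other reports, while `w` depends on them. Hence the Myerson bound is put in the
form of weights that depend on the type distribution alone: it is linear in the allocation, and can
be split state by state at the threshold after averaging. The dominant-strategy case takes a Dirac
mass as law of the state. -/

/-! ### The one-dimensional revenue bound -/

/-- A discrete form of Myerson's bound: the revenue of a monotone single-parameter mechanism on the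
types `r k` with masses `f k` is at most `∑ d k * G k`, where the weights `d k` are the decrements
of the running maximum (from the right) of the revenue curve. -/
theorem exists_weights_sum_payment_le (N : ℕ) (r f G p : ℕ → ℝ) (hr : Monotone r)
    (hr0 : 0 ≤ r 0) (hf : ∀ k, 0 ≤ f k) (hG : Monotone G) (hG0 : 0 ≤ G 0)
    (hp0 : p 0 ≤ r 0 * G 0) (hp : ∀ k, p (k + 1) - p k ≤ r (k + 1) * (G (k + 1) - G k)) :
    ∃ d : ℕ → ℝ, (∀ k < N, 0 ≤ d k ∧ d k ≤ r k * f k) ∧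
      ∑ k ∈ Finset.range N, f k * p k ≤ ∑ k ∈ Finset.range N, d k * G k ∧
      ∀ k < N, ∃ j, k ≤ j ∧ j < N ∧
        ∑ i ∈ Finset.Ico k N, d i ≤ r j * ∑ i ∈ Finset.Ico j N, f i := by
  set T : ℕ → ℝ := fun k => ∑ i ∈ Finset.Ico k N, f i with hT
  have hTs : ∀ k < N, T k = f k + T (k + 1) := fun k hk =>
    Finset.sum_eq_sum_Ico_succ_bot hk f
  have hT0 : ∀ k, 0 ≤ T k := fun k => Finset.sum_nonneg fun i _ => hf i
  have hrn : ∀ k, 0 ≤ r k := fun k => hr0.trans (hr (Nat.zero_le k))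
  -- `M k` is the best revenue of a price `r j` with `k ≤ j < N`, built by recursion from the right;
  -- the weights will be its decrements.
  obtain ⟨M, hMN, hMs⟩ : ∃ M : ℕ → ℝ, M N = 0 ∧ ∀ k < N, M k = max (r k * T k) (M (k + 1)) := by
    let m : ℕ → ℝ := fun l => Nat.rec 0 (fun l x => max (r (N - (l + 1)) * T (N - (l + 1))) x) l
    refine ⟨fun k => m (N - k), by simp [m], fun k hk => ?_⟩
    obtain ⟨l, rfl⟩ : ∃ l, N = k + (l + 1) := ⟨N - k - 1, by omega⟩
    have h1 : k + (l + 1) - k = l + 1 := by omega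
    have h2 : k + (l + 1) - (k + 1) = l := by omega
    have h3 : k + (l + 1) - (l + 1) = k := by omega
    simp only [h1, h2]
    change max (r (k + (l + 1) - (l + 1)) * T (k + (l + 1) - (l + 1))) (m l) = _
    rw [h3]
  have hTN : T N = 0 := by simp [hT]
  have hMge : ∀ k ≤ N, r k * T k ≤ M k := by
    intro k hk
    rcases hk.lt_or_eq with h | rfl
    · rw [hMs k h]; exact le_max_left _ _
    · simp [hMN, hTN]
  have hsum : ∀ k ≤ N, ∑ i ∈ Finset.Ico k N, (M i - M (i + 1)) = M k := by
    intro k hk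
    induction hk using Nat.decreasingInduction with
    | self => simp [hMN]
    | of_succ k hk ih => rw [Finset.sum_eq_sum_Ico_succ_bot hk, ih]; ring
  have hMex : ∀ k < N, ∃ j, k ≤ j ∧ j < N ∧ M k ≤ r j * T j := by
    intro k hk
    have : k ≤ N - 1 := by omega
    induction this using Nat.decreasingInduction with
    | self =>
      refine ⟨N - 1, le_rfl, hk, ?_⟩
      rw [hMs _ hk, show N - 1 + 1 = N by omega, hMN]
      exact max_le le_rfl (mul_nonneg (hrn _) (hT0 _))
    | of_succ k hk' ih =>
      rw [hMs _ hk]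
      rcases le_total (r k * T k) (M (k + 1)) with h | h
      · obtain ⟨j, h1, h2, h3⟩ := ih (by omega)
        exact ⟨j, by omega, h2, by rwa [max_eq_right h]⟩
      · exact ⟨k, le_rfl, hk, by rw [max_eq_left h]⟩
  refine ⟨fun k => M k - M (k + 1), fun k hk => ⟨?_, ?_⟩, ?_, fun k hk => ?_⟩
  · change 0 ≤ M k - M (k + 1)
    rw [hMs k hk]; linarith [le_max_right (r k * T k) (M (k + 1))]
  · change M k - M (k + 1) ≤ _
    rw [hMs k hk, sub_le_iff_le_add]
    have h1 := hMge (k + 1) hk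
    have h2 : r k * T (k + 1) ≤ r (k + 1) * T (k + 1) :=
      mul_le_mul_of_nonneg_right (hr (Nat.le_succ k)) (hT0 _)
    refine max_le ?_ ?_
    · rw [hTs k hk]; linarith
    · linarith [mul_nonneg (hrn k) (hf k)]
  -- Summation by parts from the right. Each payment increment, weighted by its tail mass, is at
  -- most `r (k + 1) * T (k + 1)` times the increment of `G`, hence at most `M (k + 1)` times it.
  · have key : ∀ k ≤ N, ∑ i ∈ Finset.Ico k N, f i * p i ≤
        p k * T k - M k * G k + ∑ i ∈ Finset.Ico k N, (M i - M (i + 1)) * G i := by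
      intro k hk
      induction hk using Nat.decreasingInduction with
      | self => simp [hMN, hTN]
      | of_succ k hk ih =>
        rw [Finset.sum_eq_sum_Ico_succ_bot hk, Finset.sum_eq_sum_Ico_succ_bot hk, hTs k hk]
        have h1 := mul_le_mul_of_nonneg_right (hp k) (hT0 (k + 1))
        have h2 := mul_le_mul_of_nonneg_right (hMge (k + 1) hk)
          (sub_nonneg.2 (hG (Nat.le_succ k)))
        simp only [Nat.succ_eq_add_one] at h2
        linarith
    have h0 := key 0 (Nat.zero_le N)
    rw [← Finset.range_eq_Ico] at h0
    have h1 := mul_le_mul_of_nonneg_right hp0 (hT0 0)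
    have h2 := mul_le_mul_of_nonneg_right (hMge 0 (Nat.zero_le N)) hG0
    linarith
  · obtain ⟨j, h1, h2, h3⟩ := hMex k hk
    exact ⟨j, h1, h2, by rw [hsum k hk.le]; exact h3⟩

/-- A finite measure that is absolutely continuous with respect to Lebesgue measure gives little
mass to each cell of a fine grid. -/
theorem exists_grid_measure_le (F : Measure ℝ) [IsFiniteMeasure F] (hF : F ≪ volume) (Z : ℝ)
    (hZ : 0 < Z) (ε : ℝ) (hε : 0 < ε) :
    ∃ N : ℕ, 0 < N ∧ ∀ k : ℕ, (F (Set.Ico (k * (Z / N)) ((k + 1 : ℕ) * (Z / N)))).toReal ≤ ε := by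
  have hfin : ∫⁻ x, F.rnDeriv volume x ≠ ⊤ := (Measure.lintegral_rnDeriv_lt_top _ _).ne
  obtain ⟨η, hη, h⟩ := exists_pos_setLIntegral_lt_of_measure_lt hfin
    (ENNReal.ofReal_pos.2 hε).ne'
  obtain ⟨η', hη', hlt⟩ : ∃ η' : ℝ, 0 < η' ∧ ENNReal.ofReal η' < η := by
    obtain ⟨q, hq, hq2⟩ := ENNReal.lt_iff_exists_nnreal_btwn.1 hη
    exact ⟨q, by exact_mod_cast hq, by simpa using hq2⟩
  obtain ⟨N, hN⟩ := exists_nat_gt (Z / η')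
  have hN0 : (0 : ℝ) < N := (div_pos hZ hη').trans hN
  refine ⟨N, by exact_mod_cast hN0, fun k => ?_⟩
  refine ENNReal.toReal_le_of_le_ofReal hε.le ?_
  rw [← Measure.withDensity_rnDeriv_eq F volume hF, withDensity_apply _ measurableSet_Ico]
  refine (h _ ?_).le
  rw [Real.volume_Ico]
  refine lt_of_le_of_lt (ENNReal.ofReal_le_ofReal ?_) hlt
  push_cast
  have : Z / N ≤ η' := by
    rw [div_le_iff₀ hN0]; rw [div_lt_iff₀ hη'] at hN; linarith
  linarith

/-- The truncation to `[0, Z)` of `lintegral_payment_le`, up to an error `ε`. -/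
theorem setLIntegral_payment_le {Ω : Type*} [MeasurableSpace Ω] (μ : Measure Ω)
    [IsProbabilityMeasure μ] (F : Measure ℝ) [IsFiniteMeasure F] (hF : F ≪ volume)
    (g : ℝ → Ω → ℝ) (hg : Measurable (Function.uncurry g)) (c : ℝ)
    (hgc : ∀ x, 0 ≤ x → ∀ᵐ ω ∂μ, 0 ≤ g x ω ∧ g x ω ≤ c) (P : ℝ → ℝ)
    (hIC : ∀ x y, 0 ≤ x → 0 ≤ y → x * ∫ ω, g y ω ∂μ - P y ≤ x * ∫ ω, g x ω ∂μ - P x)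
    (hIR : ∀ x, 0 ≤ x → P x ≤ x * ∫ ω, g x ω ∂μ)
    (w : Ω → ℝ) (hw : Measurable w) (B : Ω → ENNReal)
    (hB : ∀ᵐ ω ∂μ, 0 ≤ w ω ∧ ∀ q, w ω < q → ENNReal.ofReal q * F (Set.Ici q) ≤ B ω)
    (Z ε : ℝ) (hZ : 0 < Z) (hε : 0 < ε) :
    ∫⁻ x in Set.Ico 0 Z, ENNReal.ofReal (P x) ∂F ≤
      (∫⁻ ω, ∫⁻ x, (if x < w ω then ENNReal.ofReal (x * g x ω) else 0) ∂F ∂μ) +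
        ENNReal.ofReal c * ∫⁻ ω, B ω ∂μ + ENNReal.ofReal (2 * c * Z * ε) := by
  set G : ℝ → ℝ := fun x => ∫ ω, g x ω ∂μ with hGdef
  have hgm : ∀ x, Measurable (g x) := fun x => hg.of_uncurry_left
  have hc : 0 ≤ c := by
    obtain ⟨ω, h1, h2⟩ := (hgc 0 le_rfl).exists
    exact h1.trans h2
  have hgi : ∀ x, 0 ≤ x → Integrable (g x) μ := fun x hx =>
    Integrable.of_bound (hgm x).aestronglyMeasurable c (by
      filter_upwards [hgc x hx] with ω hω
      rw [Real.norm_eq_abs, abs_of_nonneg hω.1]; exact hω.2)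
  have hG0 : ∀ x, 0 ≤ x → 0 ≤ G x := fun x hx =>
    integral_nonneg_of_ae (by filter_upwards [hgc x hx] with ω hω using hω.1)
  have hGc : ∀ x, 0 ≤ x → G x ≤ c := fun x hx => by
    have := integral_mono_ae (hgi x hx) (integrable_const c)
      (by filter_upwards [hgc x hx] with ω hω using hω.2)
    simpa using this
  have hGm : ∀ x y, 0 ≤ x → x ≤ y → G x ≤ G y := by
    intro x y hx hxy
    rcases hxy.eq_or_lt with rfl | hlt
    · exact le_rfl
    have h1 := hIC x y hx (hx.trans hxy)
    have h2 := hIC y x (hx.trans hxy) hx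
    by_contra! h
    nlinarith [mul_pos (sub_pos.2 hlt) (sub_pos.2 h)]
  have hPG : ∀ x y, 0 ≤ x → 0 ≤ y → P y - P x ≤ y * (G y - G x) := by
    intro x y hx hy
    have h1 := hIC y x hy hx
    linarith
  have hofG : ∀ x, 0 ≤ x → ENNReal.ofReal (G x) = ∫⁻ ω, ENNReal.ofReal (g x ω) ∂μ := fun x hx =>
    ofReal_integral_eq_lintegral_ofReal (hgi x hx)
      (by filter_upwards [hgc x hx] with ω hω using hω.1)
  obtain ⟨N, hN, hmesh⟩ := exists_grid_measure_le F hF Z hZ ε hε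
  have hN' : (0 : ℝ) < N := by exact_mod_cast hN
  set r : ℕ → ℝ := fun k => k * (Z / N) with hr
  have hZN : 0 < Z / N := div_pos hZ hN'
  have hrmono : Monotone r := fun a b hab =>
    mul_le_mul_of_nonneg_right (by exact_mod_cast hab) hZN.le
  have hr0 : ∀ k, 0 ≤ r k := fun k => by positivity
  have hrN : r N = Z := by simp only [hr]; field_simp
  set A : ℕ → Set ℝ := fun k => Set.Ico (r k) (r (k + 1)) with hA
  have hAm : ∀ k, MeasurableSet (A k) := fun k => measurableSet_Ico
  have hAd : Pairwise (Function.onFun Disjoint A) := by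
    exact hrmono.pairwise_disjoint_on_Ico_succ
  have hAU : ∀ j ≤ N, ⋃ k ∈ Finset.Ico j N, A k = Set.Ico (r j) Z := by
    intro j hj
    rw [← hrN]
    induction hj using Nat.decreasingInduction with
    | self => simp
    | of_succ k hk ih =>
      have : Finset.Ico k N = insert k (Finset.Ico (k + 1) N) := by
        ext; simp; omega
      rw [this, Finset.set_biUnion_insert, ih]
      exact Set.Ico_union_Ico_eq_Ico (hrmono (Nat.le_succ k)) (hrmono hk)
  set f : ℕ → ℝ := fun k => (F (A k)).toReal with hf
  have hf0 : ∀ k, 0 ≤ f k := fun k => ENNReal.toReal_nonneg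
  have hff : ∀ k, ENNReal.ofReal (f k) = F (A k) := fun k =>
    ENNReal.ofReal_toReal (measure_ne_top _ _)
  -- Positive parts of payments still obey the downward incentive constraints, because the
  -- right-hand sides of those constraints are nonnegative.
  set p : ℕ → ℝ := fun k => max (P (r k)) 0 with hp
  have hGr : Monotone fun k => G (r k) := fun a b hab => hGm _ _ (hr0 a) (hrmono hab)
  obtain ⟨d, hd, hsum, htail⟩ := exists_weights_sum_payment_le N r f (fun k => G (r k)) p hrmono
    (hr0 0) hf0 hGr (hG0 _ (hr0 0))
    (max_le (hIR _ (hr0 0)) (mul_nonneg (hr0 0) (hG0 _ (hr0 0)))) (by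
      intro k
      have h1 := hPG (r k) (r (k + 1)) (hr0 _) (hr0 _)
      have h2 : 0 ≤ r (k + 1) * (G (r (k + 1)) - G (r k)) :=
        mul_nonneg (hr0 _) (sub_nonneg.2 (hGr (Nat.le_succ k)))
      simp only [hp]
      rw [sub_le_iff_le_add]
      refine max_le ?_ ?_
      · linarith [le_max_left (P (r k)) 0]
      · linarith [le_max_right (P (r k)) 0])
  -- The weight per unit of mass, in the role of an ironed virtual value. On a cell of mass zero `d
  -- k` vanishes, so the default value of the division is harmless.
  set φ : ℕ → ℝ := fun k => d k / f k with hφ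
  have hφ0 : ∀ k < N, 0 ≤ φ k := fun k hk => div_nonneg (hd k hk).1 (hf0 k)
  have hφr : ∀ k < N, φ k ≤ r k := fun k hk => div_le_of_le_mul₀ (hf0 k) (hr0 k) (hd k hk).2
  have hφf : ∀ k < N, φ k * f k = d k := by
    intro k hk
    rcases (hf0 k).eq_or_lt with h | h
    · have := hd k hk
      rw [← h] at this ⊢
      simp at this ⊢
      linarith
    · exact div_mul_cancel₀ _ h.ne'
  have hdε : ∀ k < N, d k ≤ Z * ε := fun k hk =>
    (hd k hk).2.trans (mul_le_mul (hrN ▸ hrmono hk.le) (hmesh k) (hf0 k) hZ.le)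
  -- the payments are controlled by those on the grid
  have grid_bound : ∫⁻ x in Set.Ico 0 Z, ENNReal.ofReal (P x) ∂F ≤
      ENNReal.ofReal (∑ k ∈ Finset.range N, d k * G (r k)) + ENNReal.ofReal (c * Z * ε) := by
    have hU : Set.Ico 0 Z = ⋃ k ∈ Finset.range N, A k := by
      rw [Finset.range_eq_Ico, hAU 0 (Nat.zero_le N)]; simp [hr]
    rw [hU, lintegral_biUnion_finset (fun a _ b _ hab => hAd hab) (fun k _ => hAm k)]
    have hk : ∀ k ∈ Finset.range N, ∫⁻ x in A k, ENNReal.ofReal (P x) ∂F ≤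
        ENNReal.ofReal (f k * p k + Z * ε * (G (r (k + 1)) - G (r k))) := by
      intro k hk
      have hkN : k < N := Finset.mem_range.1 hk
      have hGd : 0 ≤ G (r (k + 1)) - G (r k) := sub_nonneg.2 (hGr (Nat.le_succ k))
      have hp0 : 0 ≤ p k := le_max_right _ _
      calc ∫⁻ x in A k, ENNReal.ofReal (P x) ∂F
          ≤ ∫⁻ x in A k, ENNReal.ofReal (p k + Z * (G (r (k + 1)) - G (r k))) ∂F := by
            refine setLIntegral_mono measurable_const fun x hx => ENNReal.ofReal_le_ofReal ?_
            have hx0 : 0 ≤ x := (hr0 k).trans hx.1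
            have hxZ : x ≤ Z := hx.2.le.trans (hrN ▸ hrmono hkN)
            have h1 := hPG (r k) x (hr0 k) hx0
            have h2 := hGm x (r (k + 1)) hx0 hx.2.le
            have h3 : x * (G x - G (r k)) ≤ Z * (G (r (k + 1)) - G (r k)) :=
              mul_le_mul hxZ (by linarith) (sub_nonneg.2 (hGm _ _ (hr0 k) hx.1)) hZ.le
            linarith [le_max_left (P (r k)) 0]
        _ = ENNReal.ofReal ((p k + Z * (G (r (k + 1)) - G (r k))) * f k) := by
            rw [setLIntegral_const, ← hff, ENNReal.ofReal_mul (by positivity)]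
        _ ≤ _ := by
            refine ENNReal.ofReal_le_ofReal ?_
            have := mul_le_mul_of_nonneg_left (hmesh k) (mul_nonneg hZ.le hGd)
            simp only [hf, hA, hr] at this ⊢
            linarith
    refine (Finset.sum_le_sum hk).trans ?_
    rw [← ENNReal.ofReal_sum_of_nonneg, ← ENNReal.ofReal_add]
    · refine ENNReal.ofReal_le_ofReal ?_
      rw [Finset.sum_add_distrib, ← Finset.mul_sum, Finset.sum_range_sub (fun k => G (r k))]
      have h1 : G (r N) - G (r 0) ≤ c := by linarith [hGc _ (hr0 N), hG0 _ (hr0 0)]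
      have h2 := mul_le_mul_of_nonneg_left h1 (mul_nonneg hZ.le hε.le)
      linarith
    · exact Finset.sum_nonneg fun k hk =>
        mul_nonneg (hd k (Finset.mem_range.1 hk)).1 (hG0 _ (hr0 k))
    · positivity
    · intro k _
      have hGd : 0 ≤ G (r (k + 1)) - G (r k) := sub_nonneg.2 (hGr (Nat.le_succ k))
      have hp0 : 0 ≤ p k := le_max_right _ _
      have := hf0 k
      positivity
  set Φ : ℝ → ENNReal := fun x =>
    ∑ k ∈ Finset.range N, (A k).indicator (fun _ => ENNReal.ofReal (φ k)) x with hΦ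
  have hΦm : Measurable Φ := Finset.measurable_fun_sum _ fun k _ =>
    measurable_const.indicator (hAm k)
  have hΦA : ∀ k < N, ∀ x ∈ A k, Φ x = ENNReal.ofReal (φ k) := by
    intro k hk x hx
    simp only [hΦ]
    rw [Finset.sum_eq_single_of_mem k (Finset.mem_range.2 hk), Set.indicator_of_mem hx]
    intro j _ hjk
    exact Set.indicator_of_notMem (fun hj => (Set.disjoint_left.1 (hAd hjk)) hj hx) _
  have hΦx : ∀ x, Φ x ≤ ENNReal.ofReal x := by
    intro x
    by_cases h : ∃ k < N, x ∈ A k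
    · obtain ⟨k, hk, hx⟩ := h
      rw [hΦA k hk x hx]
      exact ENNReal.ofReal_le_ofReal ((hφr k hk).trans hx.1)
    · have : Φ x = 0 := Finset.sum_eq_zero fun k hk =>
        Set.indicator_of_notMem (fun hx => h ⟨k, Finset.mem_range.1 hk, hx⟩) _
      simp [this]
  have hΦ0 : ∀ x, x < 0 → Φ x = 0 := fun x hx => by
    have := hΦx x
    rwa [ENNReal.ofReal_of_nonpos hx.le, nonpos_iff_eq_zero] at this
  have weights_bound : ENNReal.ofReal (∑ k ∈ Finset.range N, d k * G (r k)) ≤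
      ∫⁻ x, Φ x * ∫⁻ ω, ENNReal.ofReal (g x ω) ∂μ ∂F := by
    rw [ENNReal.ofReal_sum_of_nonneg fun k hk =>
      mul_nonneg (hd k (Finset.mem_range.1 hk)).1 (hG0 _ (hr0 k))]
    refine le_trans ?_ (setLIntegral_le_lintegral (⋃ k ∈ Finset.range N, A k) _)
    rw [lintegral_biUnion_finset (fun a _ b _ hab => hAd hab) (fun k _ => hAm k)]
    refine Finset.sum_le_sum fun k hk => ?_
    have hkN := Finset.mem_range.1 hk
    calc ENNReal.ofReal (d k * G (r k))
        = ∫⁻ x in A k, ENNReal.ofReal (φ k) * ENNReal.ofReal (G (r k)) ∂F := by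
          rw [setLIntegral_const, ← hff, ← hφf k hkN, ENNReal.ofReal_mul
            (mul_nonneg (hφ0 k hkN) (hf0 k)), ENNReal.ofReal_mul (hφ0 k hkN)]
          ring
      _ ≤ _ := by
          refine setLIntegral_mono' (hAm k) fun x hx => ?_
          have hx0 : 0 ≤ x := (hr0 k).trans hx.1
          rw [hΦA k hkN x hx, ← hofG x hx0]
          gcongr
          exact hGm _ _ (hr0 k) hx.1
  -- Cells left of the one containing `w ω` contribute nothing, and that cell itself has weight at
  -- most `Z * ε`. The weights further right add up to the revenue of at most one price `r j`, which
  -- exceeds `w ω`.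
  have high_bound : ∀ ω, 0 ≤ w ω → (∀ q, w ω < q → ENNReal.ofReal q * F (Set.Ici q) ≤ B ω) →
      ∫⁻ x, (if x < w ω then 0 else Φ x) ∂F ≤ B ω + ENNReal.ofReal (Z * ε) := by
    intro ω hw0 hBω
    set k₀ : ℕ := ⌊w ω / (Z / N)⌋₊
    have hk1 : r k₀ ≤ w ω := by
      have := Nat.floor_le (div_nonneg hw0 hZN.le)
      rwa [le_div_iff₀ hZN] at this
    have hk2 : w ω < r (k₀ + 1) := by
      have := Nat.lt_floor_add_one (w ω / (Z / N))
      rw [div_lt_iff₀ hZN] at this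
      simpa [hr] using this
    have e1 : ∫⁻ x, (if x < w ω then 0 else Φ x) ∂F ≤
        ∑ k ∈ Finset.range N, if k < k₀ then 0 else ENNReal.ofReal (d k) := by
      calc ∫⁻ x, (if x < w ω then 0 else Φ x) ∂F
          ≤ ∫⁻ x, ∑ k ∈ Finset.range N, (A k).indicator
              (fun _ => if k < k₀ then 0 else ENNReal.ofReal (φ k)) x ∂F := by
            refine lintegral_mono fun x => ?_
            split_ifs with hx
            · exact zero_le
            · refine Finset.sum_le_sum fun k _ => ?_
              by_cases hxA : x ∈ A k
              · rw [Set.indicator_of_mem hxA, Set.indicator_of_mem hxA, if_neg]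
                intro hk
                exact hx (hxA.2.trans_le ((hrmono hk).trans hk1))
              · rw [Set.indicator_of_notMem hxA, Set.indicator_of_notMem hxA]
        _ = _ := by
            rw [lintegral_finsetSum _ fun k _ => measurable_const.indicator (hAm k)]
            refine Finset.sum_congr rfl fun k hk => ?_
            rw [lintegral_indicator_const (hAm k)]
            split_ifs
            · simp
            · rw [← hff, ← ENNReal.ofReal_mul (hφ0 k (Finset.mem_range.1 hk)),
                hφf k (Finset.mem_range.1 hk)]
    refine e1.trans ?_
    rcases le_or_gt N k₀ with hNk | hNk
    · rw [Finset.sum_eq_zero]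
      · exact zero_le
      · intro k hk
        rw [if_pos ((Finset.mem_range.1 hk).trans_le hNk)]
    rw [Finset.range_eq_Ico, ← Finset.sum_Ico_consecutive _ (Nat.zero_le k₀) hNk.le,
      Finset.sum_eq_zero (s := Finset.Ico 0 k₀) fun k hk => if_pos (Finset.mem_Ico.1 hk).2, zero_add,
      Finset.sum_eq_sum_Ico_succ_bot hNk, if_neg (lt_irrefl _), add_comm]
    refine add_le_add ?_ (ENNReal.ofReal_le_ofReal (hdε k₀ hNk))
    rw [Finset.sum_congr rfl fun k hk => if_neg (show ¬ k < k₀ by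
      have := (Finset.mem_Ico.1 hk).1; omega), ← ENNReal.ofReal_sum_of_nonneg fun k hk =>
        (hd k (Finset.mem_Ico.1 hk).2).1]
    rcases le_or_gt N (k₀ + 1) with hN1 | hN1
    · rw [Finset.Ico_eq_empty_of_le hN1]; simp
    obtain ⟨j, hj1, hj2, hj3⟩ := htail _ hN1
    refine le_trans ?_ (hBω (r j) (hk2.trans_le (hrmono hj1)))
    refine (ENNReal.ofReal_le_ofReal hj3).trans ?_
    rw [ENNReal.ofReal_mul (hr0 j), ENNReal.ofReal_sum_of_nonneg fun k _ => hf0 k]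
    gcongr
    rw [Finset.sum_congr rfl fun k _ => hff k,
      ← measure_biUnion_finset (fun a _ b _ hab => hAd hab) (fun k _ => hAm k), hAU j hj2.le]
    exact measure_mono fun x hx => hx.1
  have hlo : Measurable (Function.uncurry fun x ω =>
      if x < w ω then ENNReal.ofReal (x * g x ω) else 0) :=
    Measurable.ite (measurableSet_lt measurable_fst (hw.comp measurable_snd))
      (measurable_fst.mul hg).ennreal_ofReal measurable_const
  have hhi : Measurable (Function.uncurry fun x ω => if x < w ω then 0 else Φ x) :=
    Measurable.ite (measurableSet_lt measurable_fst (hw.comp measurable_snd))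
      measurable_const (hΦm.comp measurable_fst)
  -- `Φ` does not depend on the state, so Tonelli allows a different split for each `ω`: below the
  -- threshold use `Φ x ≤ x`, above it `g x ω ≤ c`.
  have split_bound : ∫⁻ x, Φ x * ∫⁻ ω, ENNReal.ofReal (g x ω) ∂μ ∂F ≤
      (∫⁻ ω, ∫⁻ x, (if x < w ω then ENNReal.ofReal (x * g x ω) else 0) ∂F ∂μ) +
        ENNReal.ofReal c * ∫⁻ ω, ∫⁻ x, (if x < w ω then 0 else Φ x) ∂F ∂μ := by
    rw [← lintegral_lintegral_swap hlo.aemeasurable, ← lintegral_lintegral_swap hhi.aemeasurable,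
      ← lintegral_const_mul _ hhi.lintegral_prod_right, ← lintegral_add_left hlo.lintegral_prod_right]
    refine lintegral_mono fun x => ?_
    rcases lt_or_ge x 0 with hx | hx
    · simp [hΦ0 x hx]
    rw [← lintegral_const_mul _ (hgm x).ennreal_ofReal,
      ← lintegral_const_mul _ (hhi.of_uncurry_left (x := x)),
      ← lintegral_add_left (hlo.of_uncurry_left (x := x))]
    refine lintegral_mono_ae ?_
    filter_upwards [hgc x hx] with ω hω
    split_ifs
    · rw [ENNReal.ofReal_mul hx]
      simpa using mul_le_mul_left (hΦx x) _
    · rw [zero_add, mul_comm]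
      exact mul_le_mul_left (ENNReal.ofReal_le_ofReal hω.2) _
  have high_integral_bound : ∫⁻ ω, ∫⁻ x, (if x < w ω then 0 else Φ x) ∂F ∂μ ≤
      (∫⁻ ω, B ω ∂μ) + ENNReal.ofReal (Z * ε) := by
    refine (lintegral_mono_ae (g := fun ω => B ω + ENNReal.ofReal (Z * ε)) ?_).trans ?_
    · filter_upwards [hB] with ω hω using high_bound ω hω.1 hω.2
    · rw [lintegral_add_right _ measurable_const]; simp
  calc _ ≤ _ := grid_bound
    _ ≤ _ := by
      refine (add_le_add (weights_bound.trans (split_bound.trans (add_le_add le_rfl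
        (mul_le_mul_right high_integral_bound _)))) le_rfl)
    _ = _ := by
      rw [mul_add, ← ENNReal.ofReal_mul hc, add_assoc, add_assoc, add_assoc,
        ← ENNReal.ofReal_add (by positivity) (by positivity)]
      ring_nf

/-- The one-dimensional revenue bound. The buyer has type `x` with law `F`, the state `ω` of the
world has law `μ`, and the mechanism `(g, P)` is incentive compatible and individually rational in
expectation over `ω`. Types below the threshold `w ω` pay at most their value, the others at most
`c` times the best revenue `B ω` of a posted price above the threshold. -/
theorem lintegral_payment_le {Ω : Type*} [MeasurableSpace Ω] (μ : Measure Ω)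
    [IsProbabilityMeasure μ] (F : Measure ℝ) [IsFiniteMeasure F] (hF : F ≪ volume)
    (hF0 : F (Set.Iio 0) = 0)
    (g : ℝ → Ω → ℝ) (hg : Measurable (Function.uncurry g)) (c : ℝ)
    (hgc : ∀ x, 0 ≤ x → ∀ᵐ ω ∂μ, 0 ≤ g x ω ∧ g x ω ≤ c) (P : ℝ → ℝ)
    (hIC : ∀ x y, 0 ≤ x → 0 ≤ y → x * ∫ ω, g y ω ∂μ - P y ≤ x * ∫ ω, g x ω ∂μ - P x)
    (hIR : ∀ x, 0 ≤ x → P x ≤ x * ∫ ω, g x ω ∂μ)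
    (w : Ω → ℝ) (hw : Measurable w) (B : Ω → ENNReal)
    (hB : ∀ᵐ ω ∂μ, 0 ≤ w ω ∧ ∀ q, w ω < q → ENNReal.ofReal q * F (Set.Ici q) ≤ B ω) :
    ∫⁻ x, ENNReal.ofReal (P x) ∂F ≤
      (∫⁻ ω, ∫⁻ x, (if x < w ω then ENNReal.ofReal (x * g x ω) else 0) ∂F ∂μ) +
        ENNReal.ofReal c * ∫⁻ ω, B ω ∂μ := by
  have hc : 0 ≤ c := by
    obtain ⟨ω, h1, h2⟩ := (hgc 0 le_rfl).exists
    exact h1.trans h2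
  have hU : ∫⁻ x, ENNReal.ofReal (P x) ∂F =
      ⨆ Z : ℕ, ∫⁻ x in Set.Ico (0 : ℝ) (Z + 1 : ℕ), ENNReal.ofReal (P x) ∂F := by
    rw [← setLIntegral_iUnion_of_directed]
    · have : ⋃ Z : ℕ, Set.Ico (0 : ℝ) (Z + 1 : ℕ) = (Set.Iio 0)ᶜ := by
        ext x
        simp only [Set.mem_iUnion, Set.mem_Ico, Set.mem_compl_iff, Set.mem_Iio, not_lt]
        refine ⟨fun ⟨_, h⟩ => h.1, fun h => ?_⟩
        obtain ⟨k, hk⟩ := exists_nat_gt x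
        exact ⟨k, h, by push_cast; linarith⟩
      rw [this, Measure.restrict_eq_self_of_ae_mem]
      exact measure_eq_zero_iff_ae_notMem.1 hF0
    · refine Monotone.directed_le fun a b hab => Set.Ico_subset_Ico le_rfl ?_
      exact_mod_cast Nat.succ_le_succ hab
  rw [hU]
  refine iSup_le fun Z => ENNReal.le_of_forall_pos_le_add fun ε hε _ => ?_
  have hZ : (0 : ℝ) < (Z + 1 : ℕ) := by positivity
  -- The error of the truncated bound is `2 * c * Z` times the mesh parameter; the added `1` allows
  -- division when `c = 0`.
  have hK : 0 < 2 * c * (Z + 1 : ℕ) + 1 := by positivity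
  refine (setLIntegral_payment_le μ F hF g hg c hgc P hIC hIR w hw B hB _
    (ε / (2 * c * (Z + 1 : ℕ) + 1)) hZ (div_pos hε hK)).trans ?_
  gcongr
  rw [← ENNReal.ofReal_coe_nnreal]
  refine ENNReal.ofReal_le_ofReal ?_
  rw [mul_div_assoc', div_le_iff₀ hK]
  nlinarith [ε.2]

/-! ### One perturbed buyer in ray coordinates -/

/-- The perturbed values of a single buyer. -/
def bump (v ε : Fin 2 → ℝ) : Fin 2 → ℝ := fun j => v j + ε j * max (v 0) (v 1)

/-- The perturbation of the two values of a single buyer. -/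
noncomputable def buyerNoise (δ : ℝ) : Measure (Fin 2 → ℝ) :=
  Measure.pi fun _ : Fin 2 => volume[|Set.Icc 0 δ]

/-- The law of the perturbed values of a buyer whose values have law `κ`. -/
noncomputable def smooth (δ : ℝ) (κ : Measure (Fin 2 → ℝ)) : Measure (Fin 2 → ℝ) :=
  (κ.prod (buyerNoise δ)).map fun p => bump p.1 p.2

/-- The point with `s`-th coordinate `x` whose other coordinate is `t * x`. -/
def ray (s : Fin 2) (t x : ℝ) : Fin 2 → ℝ := fun j => if j = s then x else t * x

/-- The density at `y` of the perturbed values of a buyer with values `v ≠ 0`. -/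
noncomputable def squareDensity (δ : ℝ) (v y : Fin 2 → ℝ) : ENNReal :=
  if ∀ j, v j ≤ y j ∧ y j ≤ v j + δ * max (v 0) (v 1)
  then (ENNReal.ofReal (δ * max (v 0) (v 1)))⁻¹ ^ 2 else 0

/-- The density of the perturbed values along the ray with side `s` and slope `t`, in the coordinates
`(t, x)`; the factor `x` is the Jacobian. -/
noncomputable def rayDensity (δ : ℝ) (κ : Measure (Fin 2 → ℝ)) (s : Fin 2) (t x : ℝ) : ENNReal :=
  ENNReal.ofReal x * ∫⁻ v, squareDensity δ v (ray s t x) ∂κ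

theorem measurable_bump : Measurable fun p : (Fin 2 → ℝ) × (Fin 2 → ℝ) => bump p.1 p.2 := by
  unfold bump; fun_prop

theorem measurable_ray (s : Fin 2) : Measurable fun p : ℝ × ℝ => ray s p.1 p.2 := by
  refine measurable_pi_lambda _ fun j => ?_
  by_cases h : j = s
  · simp only [ray, h, if_true]; fun_prop
  · simp only [ray, h, if_false]; fun_prop

theorem measurable_squareDensity (δ : ℝ) :
    Measurable fun p : (Fin 2 → ℝ) × (Fin 2 → ℝ) => squareDensity δ p.1 p.2 := by
  refine Measurable.ite ?_ (by fun_prop) measurable_const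
  simp only [Set.ofPred_forall, Set.ofPred_and]
  refine MeasurableSet.iInter fun j => (measurableSet_le ?_ ?_).inter (measurableSet_le ?_ ?_) <;>
    fun_prop

theorem measurable_rayDensity (δ : ℝ) (κ : Measure (Fin 2 → ℝ)) [SFinite κ] (s : Fin 2) :
    Measurable fun p : ℝ × ℝ => rayDensity δ κ s p.1 p.2 := by
  refine measurable_snd.ennreal_ofReal.mul (Measurable.lintegral_prod_right ?_)
  exact (measurable_squareDensity δ).comp
    (measurable_snd.prodMk ((measurable_ray s).comp measurable_fst))

theorem isProbabilityMeasure_cond_Icc {δ : ℝ} (hδ : 0 < δ) :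
    IsProbabilityMeasure (volume[|Set.Icc 0 δ]) :=
  cond_isProbabilityMeasure_of_finite (by simp [hδ]) (by simp)

theorem isProbabilityMeasure_buyerNoise {δ : ℝ} (hδ : 0 < δ) :
    IsProbabilityMeasure (buyerNoise δ) := by
  have := isProbabilityMeasure_cond_Icc hδ
  unfold buyerNoise; infer_instance

theorem isProbabilityMeasure_smooth {δ : ℝ} (hδ : 0 < δ) (κ : Measure (Fin 2 → ℝ))
    [IsProbabilityMeasure κ] : IsProbabilityMeasure (smooth δ κ) := by
  have := isProbabilityMeasure_buyerNoise hδ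
  exact Measure.isProbabilityMeasure_map measurable_bump.aemeasurable

theorem lintegral_mul_right_volume (f : ℝ → ENNReal) (hf : Measurable f) {m : ℝ} (hm : 0 < m) :
    ∫⁻ x, f x = ENNReal.ofReal m * ∫⁻ t, f (t * m) := by
  conv_lhs => rw [← Real.smul_map_volume_mul_right hm.ne']
  rw [lintegral_smul_measure, lintegral_map hf (by fun_prop), abs_of_pos hm, smul_eq_mul]

/-- Affine change of variables: scaling a uniform variable on `[0, δ]` by `m` and translating it by
`a` makes it uniform on `[a, a + δ * m]`. -/
theorem lintegral_uniform (f : ℝ → ENNReal) (hf : Measurable f) {δ m : ℝ} (hδ : 0 < δ)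
    (hm : 0 < m) (a : ℝ) :
    ∫⁻ e, f (a + e * m) ∂(volume[|Set.Icc 0 δ]) =
      ∫⁻ y, f y * (if a ≤ y ∧ y ≤ a + δ * m then (ENNReal.ofReal (δ * m))⁻¹ else 0) := by
  set φ : ℝ → ENNReal := fun y =>
    f y * (if a ≤ y ∧ y ≤ a + δ * m then (ENNReal.ofReal (δ * m))⁻¹ else 0) with hφ
  have hφm : Measurable φ := hf.mul (Measurable.ite
    ((measurableSet_le measurable_const measurable_id).inter
      (measurableSet_le measurable_id measurable_const)) measurable_const measurable_const)
  have h1 : ∫⁻ y, φ y = ENNReal.ofReal m * ∫⁻ e, φ (a + e * m) := by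
    rw [← lintegral_add_left_eq_self φ a, lintegral_mul_right_volume (fun x => φ (a + x)) (by fun_prop) hm]
  have hφm' : Measurable fun e => φ (a + e * m) := by fun_prop
  have hfm : Measurable fun e => f (a + e * m) := by fun_prop
  rw [h1, ProbabilityTheory.cond, lintegral_smul_measure, Real.volume_Icc, sub_zero,
    ← lintegral_indicator measurableSet_Icc, smul_eq_mul,
    ← lintegral_const_mul _ hφm',
    ← lintegral_const_mul _ (hfm.indicator measurableSet_Icc)]
  refine lintegral_congr fun e => ?_
  have hiff : (a ≤ a + e * m ∧ a + e * m ≤ a + δ * m) ↔ e ∈ Set.Icc 0 δ := by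
    rw [Set.mem_Icc, le_add_iff_nonneg_right, add_le_add_iff_left, mul_le_mul_iff_left₀ hm,
      mul_nonneg_iff_left_nonneg_of_pos hm]
  by_cases he : e ∈ Set.Icc 0 δ
  · simp only [hφ, if_pos (hiff.2 he), Set.indicator_of_mem he]
    rw [ENNReal.ofReal_mul hδ.le, ENNReal.mul_inv (Or.inl (by simpa using hδ))
      (Or.inl ENNReal.ofReal_ne_top)]
    have : ENNReal.ofReal m * (ENNReal.ofReal m)⁻¹ = 1 :=
      ENNReal.mul_inv_cancel (by simpa using hm) ENNReal.ofReal_ne_top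
    calc _ = (ENNReal.ofReal m * (ENNReal.ofReal m)⁻¹) *
          ((ENNReal.ofReal δ)⁻¹ * f (a + e * m)) := by rw [this, one_mul]
      _ = _ := by ring
  · simp only [hφ, if_neg (fun h => he (hiff.1 h)), Set.indicator_of_notMem he, mul_zero]

/-- Once the values are fixed and not both zero, the two coordinates are independent uniforms with
the same scale, so their joint density is constant on a square. -/
theorem lintegral_bump (ψ : (Fin 2 → ℝ) → ENNReal) (hψ : Measurable ψ) {δ : ℝ} (hδ : 0 < δ)
    (v : Fin 2 → ℝ) (hm : 0 < max (v 0) (v 1)) :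
    ∫⁻ ε, ψ (bump v ε) ∂(buyerNoise δ) =
      ∫⁻ y₀, ∫⁻ y₁, ψ ![y₀, y₁] * squareDensity δ v ![y₀, y₁] := by
  have := isProbabilityMeasure_cond_Icc hδ
  set m := max (v 0) (v 1)
  have hpair : Measurable fun p : ℝ × ℝ => (![p.1, p.2] : Fin 2 → ℝ) := by
    refine measurable_pi_lambda _ fun j => ?_
    fin_cases j
    · exact measurable_fst
    · exact measurable_snd
  set u : ℝ → ℝ → ENNReal := fun a y =>
    if a ≤ y ∧ y ≤ a + δ * m then (ENNReal.ofReal (δ * m))⁻¹ else 0 with hu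
  have hum : ∀ a, Measurable (u a) := fun a => Measurable.ite
    ((measurableSet_le measurable_const measurable_id).inter
      (measurableSet_le measurable_id measurable_const)) measurable_const measurable_const
  have e1 : ∀ ε : Fin 2 → ℝ, bump v ε = ![v 0 + ε 0 * m, v 1 + ε 1 * m] := by
    intro ε; ext j; fin_cases j <;> rfl
  calc ∫⁻ ε, ψ (bump v ε) ∂(buyerNoise δ)
      = ∫⁻ p : ℝ × ℝ, ψ ![v 0 + p.1 * m, v 1 + p.2 * m]
          ∂((volume[|Set.Icc 0 δ]).prod (volume[|Set.Icc 0 δ])) := by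
        rw [← (measurePreserving_piFinTwo fun _ : Fin 2 => volume[|Set.Icc 0 δ]).lintegral_comp]
        · exact lintegral_congr fun ε => by rw [e1]; rfl
        · exact hψ.comp (hpair.comp (by fun_prop :
            Measurable fun p : ℝ × ℝ => (v 0 + p.1 * m, v 1 + p.2 * m)))
    _ = ∫⁻ e₀, ∫⁻ e₁, ψ ![v 0 + e₀ * m, v 1 + e₁ * m]
          ∂(volume[|Set.Icc 0 δ]) ∂(volume[|Set.Icc 0 δ]) :=
        lintegral_prod _ (hψ.comp (hpair.comp (by fun_prop :
            Measurable fun p : ℝ × ℝ => (v 0 + p.1 * m, v 1 + p.2 * m)))).aemeasurable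
    _ = ∫⁻ e₀, (∫⁻ y₁, ψ ![v 0 + e₀ * m, y₁] * u (v 1) y₁) ∂(volume[|Set.Icc 0 δ]) := by
        refine lintegral_congr fun e₀ => ?_
        exact lintegral_uniform (fun y => ψ ![v 0 + e₀ * m, y])
          (hψ.comp (hpair.comp (by fun_prop : Measurable fun y : ℝ => (v 0 + e₀ * m, y)))) hδ hm _
    _ = ∫⁻ y₀, (∫⁻ y₁, ψ ![y₀, y₁] * u (v 1) y₁) * u (v 0) y₀ := by
        refine lintegral_uniform (fun y => ∫⁻ y₁, ψ ![y, y₁] * u (v 1) y₁) ?_ hδ hm _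
        exact Measurable.lintegral_prod_right
          ((hψ.comp hpair).mul ((hum _).comp measurable_snd))
    _ = _ := by
        refine lintegral_congr fun y₀ => ?_
        have hm1 : Measurable fun y₁ => ψ ![y₀, y₁] * u (v 1) y₁ := (hψ.comp (hpair.comp
          (by fun_prop : Measurable fun y : ℝ => (y₀, y)))).mul (hum _)
        rw [← lintegral_mul_const _ hm1]
        refine lintegral_congr fun y₁ => ?_
        rw [mul_assoc]
        congr 1
        simp only [hu, squareDensity, Fin.forall_fin_two, Matrix.cons_val_zero, Matrix.cons_val_one]
        by_cases h0 : v 0 ≤ y₀ ∧ y₀ ≤ v 0 + δ * m <;> by_cases h1 : v 1 ≤ y₁ ∧ y₁ ≤ v 1 + δ * m <;>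
          simp [h0, h1, m, sq]

theorem setLIntegral_Ioo_eq_mul (f : ℝ → ENNReal) (hf : Measurable f) {x : ℝ} (hx : 0 < x) :
    ∫⁻ y in Set.Ioo 0 x, f y = ENNReal.ofReal x * ∫⁻ t in Set.Ioo 0 1, f (t * x) := by
  rw [← lintegral_indicator measurableSet_Ioo,
    lintegral_mul_right_volume _ (hf.indicator measurableSet_Ioo) hx,
    ← lintegral_indicator measurableSet_Ioo]
  congr 1
  refine lintegral_congr fun t => ?_
  have : t * x ∈ Set.Ioo 0 x ↔ t ∈ Set.Ioo (0 : ℝ) 1 := by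
    rw [Set.mem_Ioo, Set.mem_Ioo, mul_pos_iff_of_pos_right hx, mul_lt_iff_lt_one_left hx]
  by_cases h : t ∈ Set.Ioo (0 : ℝ) 1
  · rw [Set.indicator_of_mem h, Set.indicator_of_mem (this.2 h)]
  · rw [Set.indicator_of_notMem h, Set.indicator_of_notMem (fun h' => h (this.1 h'))]

/-- Integration over the quadrant in the coordinates given by the slope and the larger
coordinate. -/
theorem lintegral_quadrant (Ψ : ℝ → ℝ → ENNReal) (hΨ : Measurable (Function.uncurry Ψ)) :
    ∫⁻ y₀ in Set.Ioi 0, ∫⁻ y₁ in Set.Ioi 0, Ψ y₀ y₁ =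
      (∫⁻ t in Set.Ioo 0 1, ∫⁻ x in Set.Ioi 0, ENNReal.ofReal x * Ψ x (t * x)) +
        ∫⁻ t in Set.Ioo 0 1, ∫⁻ x in Set.Ioi 0, ENNReal.ofReal x * Ψ (t * x) x := by
  have half : ∀ Ψ : ℝ → ℝ → ENNReal, Measurable (Function.uncurry Ψ) →
      ∫⁻ x in Set.Ioi 0, ∫⁻ y in Set.Ioo 0 x, Ψ x y =
        ∫⁻ t in Set.Ioo 0 1, ∫⁻ x in Set.Ioi 0, ENNReal.ofReal x * Ψ x (t * x) := by
    intro Ψ hΨ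
    rw [← lintegral_lintegral_swap]
    · refine setLIntegral_congr_fun measurableSet_Ioi fun x hx => ?_
      rw [setLIntegral_Ioo_eq_mul _ hΨ.of_uncurry_left hx, lintegral_const_mul]
      exact hΨ.comp (by fun_prop : Measurable fun t : ℝ => (x, t * x))
    · exact (measurable_fst.ennreal_ofReal.mul
        (hΨ.comp (by fun_prop : Measurable fun p : ℝ × ℝ => (p.1, p.2 * p.1)))).aemeasurable
  rw [← half Ψ hΨ, ← half (fun x y => Ψ y x) (hΨ.comp measurable_swap)]
  -- Tonelli on the triangle `0 < y < x`, so that both halves of the quadrant have the same outer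
  -- variable.
  have e1 : ∫⁻ x in Set.Ioi 0, ∫⁻ y in Set.Ioo 0 x, Ψ y x =
      ∫⁻ y in Set.Ioi 0, ∫⁻ x in Set.Ioi y, Ψ y x := by
    have a1 : ∫⁻ x in Set.Ioi 0, ∫⁻ y in Set.Ioo 0 x, Ψ y x =
        ∫⁻ x in Set.Ioi 0, ∫⁻ y in Set.Ioi 0, if y < x then Ψ y x else 0 := by
      refine setLIntegral_congr_fun measurableSet_Ioi fun x hx => ?_
      rw [← lintegral_indicator measurableSet_Ioo, ← lintegral_indicator measurableSet_Ioi]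
      refine lintegral_congr fun y => ?_
      simp only [Set.indicator, Set.mem_Ioo, Set.mem_Ioi]
      by_cases h0 : 0 < y <;> by_cases h1 : y < x <;> simp [h0, h1]
    have a2 : ∫⁻ y in Set.Ioi 0, ∫⁻ x in Set.Ioi y, Ψ y x =
        ∫⁻ y in Set.Ioi 0, ∫⁻ x in Set.Ioi 0, if y < x then Ψ y x else 0 := by
      refine setLIntegral_congr_fun measurableSet_Ioi fun y hy => ?_
      rw [← lintegral_indicator measurableSet_Ioi, ← lintegral_indicator measurableSet_Ioi]
      refine lintegral_congr fun x => ?_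
      have hy : 0 < y := hy
      simp only [Set.indicator, Set.mem_Ioi]
      by_cases h1 : y < x
      · simp [h1, hy.trans h1]
      · simp [h1]
    rw [a1, a2, lintegral_lintegral_swap]
    exact (Measurable.ite (measurableSet_lt measurable_snd measurable_fst)
      (hΨ.comp measurable_swap) measurable_const).aemeasurable
  rw [e1, ← lintegral_add_right]
  · refine setLIntegral_congr_fun measurableSet_Ioi fun y hy => ?_
    have hy : 0 < y := hy
    rw [← Set.Ioc_union_Ioi_eq_Ioi hy.le, lintegral_union measurableSet_Ioi
      (Set.Ioc_disjoint_Ioi le_rfl), setLIntegral_congr Ioo_ae_eq_Ioc]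
  · have : (fun y => ∫⁻ x in Set.Ioi y, Ψ y x) =
        fun y => ∫⁻ x, if y < x then Ψ y x else 0 := by
      funext y
      rw [← lintegral_indicator measurableSet_Ioi]
      rfl
    rw [this]
    exact Measurable.lintegral_prod_right
      (Measurable.ite (measurableSet_lt measurable_fst measurable_snd) hΨ measurable_const)

theorem lintegral_smooth (δ : ℝ) (κ : Measure (Fin 2 → ℝ)) [SFinite κ] (hδ : 0 < δ)
    (ψ : (Fin 2 → ℝ) → ENNReal) (hψ : Measurable ψ) :
    ∫⁻ z, ψ z ∂(smooth δ κ) = ∫⁻ v, ∫⁻ ε, ψ (bump v ε) ∂(buyerNoise δ) ∂κ := by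
  have := isProbabilityMeasure_buyerNoise hδ
  rw [smooth, lintegral_map hψ measurable_bump]
  exact lintegral_prod _ (hψ.comp measurable_bump).aemeasurable

/-- The perturbed law, disintegrated into rays. -/
theorem lintegral_smooth_eq_rays {δ : ℝ} (hδ : 0 < δ) (κ : Measure (Fin 2 → ℝ)) [SFinite κ]
    (hκ : ∀ᵐ v ∂κ, 0 ≤ v) (ψ : (Fin 2 → ℝ) → ENNReal) (hψ : Measurable ψ) (hψ0 : ψ 0 = 0) :
    ∫⁻ z, ψ z ∂(smooth δ κ) =
      ∑ s, ∫⁻ t in Set.Ioo 0 1, ∫⁻ x in Set.Ioi 0, ψ (ray s t x) * rayDensity δ κ s t x := by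
  rw [lintegral_smooth δ κ hδ ψ hψ]
  set I : Fin 2 → ℝ → ℝ → (Fin 2 → ℝ) → ENNReal := fun s t x v =>
    ENNReal.ofReal x * (ψ (ray s t x) * squareDensity δ v (ray s t x))
  have hI : ∀ s, Measurable fun p : (ℝ × ℝ) × (Fin 2 → ℝ) => I s p.1.1 p.1.2 p.2 := fun s =>
    measurable_fst.snd.ennreal_ofReal.mul
      ((hψ.comp ((measurable_ray s).comp measurable_fst)).mul ((measurable_squareDensity δ).comp
        (measurable_snd.prodMk ((measurable_ray s).comp measurable_fst))))
  have hpair : Measurable fun p : ℝ × ℝ => (![p.1, p.2] : Fin 2 → ℝ) := by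
    refine measurable_pi_lambda _ fun j => ?_
    fin_cases j
    · exact measurable_fst
    · exact measurable_snd
  have e1 : ∀ᵐ v ∂κ, ∫⁻ ε, ψ (bump v ε) ∂(buyerNoise δ) =
      ∑ s, ∫⁻ t in Set.Ioo 0 1, ∫⁻ x in Set.Ioi 0, I s t x v := by
    filter_upwards [hκ] with v hv
    have hv0 : 0 ≤ v 0 := hv 0
    have hv1 : 0 ≤ v 1 := hv 1
    rcases (le_max_of_le_left hv0 : 0 ≤ max (v 0) (v 1)).eq_or_lt with hm | hm
    -- The perturbation is multiplicative, so zero values stay an atom at the origin. No ray sees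
    -- that atom since `x > 0` there; this is why `ψ 0 = 0` is required.
    · have h0 : v 0 = 0 := le_antisymm (hm ▸ le_max_left _ _) hv0
      have h1 : v 1 = 0 := le_antisymm (hm ▸ le_max_right _ _) hv1
      have hb : ∀ ε, bump v ε = 0 := by
        intro ε; ext j; fin_cases j <;> simp [bump, h0, h1]
      simp only [hb, hψ0, lintegral_zero]
      symm
      refine Finset.sum_eq_zero fun s _ => ?_
      have : ∀ t : ℝ, ∫⁻ x in Set.Ioi 0, I s t x v = 0 := by
        intro t
        rw [setLIntegral_congr_fun (g := fun _ => 0) measurableSet_Ioi, lintegral_zero]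
        intro x hx
        have hx : 0 < x := hx
        have : squareDensity δ v (ray s t x) = 0 := by
          rw [squareDensity, if_neg]
          intro h
          have h2 := (h s).2
          have hs : v s = 0 := by fin_cases s <;> assumption
          rw [← hm, mul_zero, hs] at h2
          simp [ray] at h2
          linarith
        simp [I, this]
      simp [this]
    · rw [lintegral_bump ψ hψ hδ v hm, Fin.sum_univ_two]
      have key := lintegral_quadrant (fun y₀ y₁ => ψ ![y₀, y₁] * squareDensity δ v ![y₀, y₁])
        ((hψ.comp hpair).mul ((measurable_squareDensity δ).comp (measurable_const.prodMk hpair)))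
      have r0 : ∀ t x : ℝ, ray 0 t x = ![x, t * x] := by
        intro t x; ext j; fin_cases j <;> simp [ray]
      have r1 : ∀ t x : ℝ, ray 1 t x = ![t * x, x] := by
        intro t x; ext j; fin_cases j <;> simp [ray]
      simp only [I, r0, r1]
      rw [← key]
      have z0 : ∀ y₀ y₁ : ℝ, y₀ < 0 ∨ y₁ < 0 → squareDensity δ v ![y₀, y₁] = 0 := by
        intro y₀ y₁ h
        rw [squareDensity, if_neg]
        intro h'
        have a0 := (h' 0).1
        have a1 := (h' 1).1
        simp at a0 a1
        rcases h with h | h <;> linarith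
      have s1 : ∀ f : ℝ → ENNReal, (∀ y < 0, f y = 0) → ∫⁻ y, f y = ∫⁻ y in Set.Ioi 0, f y := by
        intro f hf
        rw [setLIntegral_congr Ioi_ae_eq_Ici, ← lintegral_indicator measurableSet_Ici]
        refine lintegral_congr fun y => ?_
        by_cases hy : y ∈ Set.Ici (0 : ℝ)
        · rw [Set.indicator_of_mem hy]
        · rw [Set.indicator_of_notMem hy, hf y (not_le.1 hy)]
      rw [s1]
      · refine lintegral_congr fun y₀ => s1 _ fun y₁ h => ?_
        rw [z0 _ _ (Or.inr h), mul_zero]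
      · intro y₀ h
        simp [z0 _ _ (Or.inl h)]
  have hI2 : ∀ s, Measurable fun p : (Fin 2 → ℝ) × ℝ => ∫⁻ x in Set.Ioi 0, I s p.2 x p.1 := by
    intro s
    refine Measurable.lintegral_prod_right ?_
    exact (hI s).comp (by fun_prop :
      Measurable fun p : ((Fin 2 → ℝ) × ℝ) × ℝ => ((p.1.2, p.2), p.1.1))
  rw [lintegral_congr_ae e1, lintegral_finsetSum]
  · refine Finset.sum_congr rfl fun s _ => ?_
    rw [lintegral_lintegral_swap (hI2 s).aemeasurable]
    refine lintegral_congr fun t => ?_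
    rw [lintegral_lintegral_swap]
    · refine lintegral_congr fun x => ?_
      have hm : Measurable fun v => squareDensity δ v (ray s t x) :=
        (measurable_squareDensity δ).comp (measurable_id.prodMk measurable_const)
      simp only [I, rayDensity]
      rw [lintegral_const_mul _ (hm.const_mul _), lintegral_const_mul _ hm]
      ring
    · exact ((hI s).comp (by fun_prop :
        Measurable fun p : (Fin 2 → ℝ) × ℝ => ((t, p.2), p.1))).aemeasurable
  · intro s _
    exact Measurable.lintegral_prod_right (hI2 s)

/-! ### Prices on a ray against prices for the bundle -/

/-- The law along a ray. -/
noncomputable def rayMeasure (δ : ℝ) (κ : Measure (Fin 2 → ℝ)) (s : Fin 2) (t : ℝ) : Measure ℝ :=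
  (volume.restrict (Set.Ioi 0)).withDensity (rayDensity δ κ s t)

/-- The optimal revenue of a posted price above `w` for the grand bundle. -/
noncomputable def postedRevenue (K : Measure (Fin 2 → ℝ)) (w : ℝ) : ENNReal :=
  ⨆ q : ℚ, if w < q then ENNReal.ofReal q * K {z | (q : ℝ) ≤ ∑ j, z j} else 0

theorem measurableSet_le_sum (q : ℝ) : MeasurableSet {z : Fin 2 → ℝ | q ≤ ∑ j, z j} :=
  measurableSet_le measurable_const (by fun_prop)

theorem sum_ray (s : Fin 2) (t x : ℝ) : ∑ j, ray s t x j = x * (1 + t) := by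
  fin_cases s <;> simp [ray] <;> ring

/-- Rational prices suffice: a rational just below `Q`, still above `w`, sells at least as often and
earns almost as much per sale. -/
theorem ofReal_mul_measure_le_postedRevenue (K : Measure (Fin 2 → ℝ)) [IsFiniteMeasure K]
    {w Q : ℝ} (h : w < Q) :
    ENNReal.ofReal Q * K {z | Q ≤ ∑ j, z j} ≤ postedRevenue K w := by
  by_contra! hlt
  have hcont : Tendsto (fun x => ENNReal.ofReal x * K {z | Q ≤ ∑ j, z j}) (𝓝[<] Q)
      (𝓝 (ENNReal.ofReal Q * K {z | Q ≤ ∑ j, z j})) := by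
    refine Tendsto.mono_left ?_ nhdsWithin_le_nhds
    exact ENNReal.Tendsto.mul_const (ENNReal.continuous_ofReal.tendsto Q)
      (Or.inr (measure_ne_top _ _))
  have hev := (hcont.eventually (lt_mem_nhds hlt)).and (Ioo_mem_nhdsLT h)
  obtain ⟨l, hl, hsub⟩ := (mem_nhdsLT_iff_exists_Ioo_subset (a := Q)).1 hev
  obtain ⟨q, hq1, hq2⟩ := exists_rat_btwn (show l < Q from hl)
  obtain ⟨h1, h2⟩ := hsub ⟨hq1, hq2⟩
  refine absurd h1 (not_lt.2 ?_)
  refine le_trans ?_ (le_iSup _ q)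
  rw [if_pos h2.1]
  exact mul_le_mul_right (measure_mono fun z hz => h2.2.le.trans hz) _

/-- The prices `w + 1 / (n + 1)` lie strictly above `w`, and their events of sale increase to the
open half-space. -/
theorem ofReal_mul_measure_lt_le_postedRevenue (K : Measure (Fin 2 → ℝ)) [IsFiniteMeasure K]
    (w : ℝ) : ENNReal.ofReal w * K {z | w < ∑ j, z j} ≤ postedRevenue K w := by
  have hU : {z : Fin 2 → ℝ | w < ∑ j, z j} =
      ⋃ n : ℕ, {z | w + 1 / ((n : ℝ) + 1) ≤ ∑ j, z j} := by
    ext z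
    simp only [Set.mem_ofPred_eq, Set.mem_iUnion]
    refine ⟨fun h => ?_, fun ⟨n, hn⟩ => lt_of_lt_of_le (by
      have : (0 : ℝ) < 1 / ((n : ℝ) + 1) := by positivity
      linarith) hn⟩
    obtain ⟨n, hn⟩ := exists_nat_one_div_lt (sub_pos.2 h)
    exact ⟨n, by linarith⟩
  have hmono : Monotone fun n : ℕ => {z : Fin 2 → ℝ | w + 1 / ((n : ℝ) + 1) ≤ ∑ j, z j} := by
    intro a b hab z hz
    have : (1 : ℝ) / ((b : ℝ) + 1) ≤ 1 / ((a : ℝ) + 1) := Nat.one_div_le_one_div hab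
    simp only [Set.mem_ofPred_eq] at hz ⊢
    linarith
  rw [hU, hmono.measure_iUnion, ENNReal.mul_iSup]
  refine iSup_le fun n => ?_
  have hpos : (0 : ℝ) < 1 / ((n : ℝ) + 1) := by positivity
  refine le_trans ?_ (ofReal_mul_measure_le_postedRevenue K (w := w)
    (Q := w + 1 / ((n : ℝ) + 1)) (by linarith))
  gcongr
  linarith

theorem ae_nonneg_buyerNoise {δ : ℝ} (hδ : 0 < δ) : ∀ᵐ ε ∂(buyerNoise δ), 0 ≤ ε := by
  have := isProbabilityMeasure_cond_Icc hδ
  have h0 : ∀ᵐ e ∂(volume[|Set.Icc 0 δ]), (0 : ℝ) ≤ e :=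
    (ae_cond_mem measurableSet_Icc).mono fun e he => he.1
  exact ae_all_iff.2 fun j => (Measure.tendsto_eval_ae_ae
    (μ := fun _ : Fin 2 => volume[|Set.Icc 0 δ]) (i := j)).eventually h0

theorem le_bump {v ε : Fin 2 → ℝ} (hv : 0 ≤ v) (hε : 0 ≤ ε) : v ≤ bump v ε := fun j =>
  le_add_of_nonneg_right (mul_nonneg (hε j) (le_max_of_le_left (hv 0)))

theorem ae_nonneg_smooth {δ : ℝ} (hδ : 0 < δ) (κ : Measure (Fin 2 → ℝ)) [SFinite κ]
    (hκ : ∀ᵐ v ∂κ, 0 ≤ v) : ∀ᵐ z ∂(smooth δ κ), 0 ≤ z := by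
  have := isProbabilityMeasure_buyerNoise hδ
  have hS : MeasurableSet {z : Fin 2 → ℝ | 0 ≤ z} := measurableSet_Ici
  rw [smooth, ae_map_iff measurable_bump.aemeasurable hS]
  have a1 : ∀ᵐ p ∂(κ.prod (buyerNoise δ)), 0 ≤ p.1 := Measure.quasiMeasurePreserving_fst.ae hκ
  have a2 : ∀ᵐ p ∂(κ.prod (buyerNoise δ)), 0 ≤ p.2 :=
    Measure.quasiMeasurePreserving_snd.ae (ae_nonneg_buyerNoise hδ)
  filter_upwards [a1, a2] with p h1 h2 using h1.trans (le_bump h1 h2)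

/-- Perturbing never lowers a value, and a sum of nonnegative values is at least their maximum. This
turns a tail of the unperturbed maximum into the sale probability of a bundle price. -/
theorem measure_max_le_measure_sum {δ : ℝ} (hδ : 0 < δ) (κ : Measure (Fin 2 → ℝ)) [SFinite κ]
    (hκ : ∀ᵐ v ∂κ, 0 ≤ v) (q : ℝ) :
    κ {v | q ≤ max (v 0) (v 1)} ≤ smooth δ κ {z | q ≤ ∑ j, z j} := by
  have := isProbabilityMeasure_buyerNoise hδ
  rw [smooth, Measure.map_apply measurable_bump (measurableSet_le_sum q)]
  have h1 : κ {v | q ≤ max (v 0) (v 1)} =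
      (κ.prod (buyerNoise δ)) ({v | q ≤ max (v 0) (v 1)} ×ˢ Set.univ) := by
    rw [Measure.prod_prod, measure_univ, mul_one]
  rw [h1]
  refine measure_mono_ae ?_
  have a1 : ∀ᵐ p ∂(κ.prod (buyerNoise δ)), 0 ≤ p.1 := Measure.quasiMeasurePreserving_fst.ae hκ
  have a2 : ∀ᵐ p ∂(κ.prod (buyerNoise δ)), 0 ≤ p.2 :=
    Measure.quasiMeasurePreserving_snd.ae (ae_nonneg_buyerNoise hδ)
  filter_upwards [a1, a2] with p hp1 hp2 hp
  have hq : q ≤ max (p.1 0) (p.1 1) := hp.1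
  change q ≤ ∑ j, bump p.1 p.2 j
  refine hq.trans (le_trans ?_ (Finset.sum_le_sum fun j _ => le_bump hp1 hp2 j))
  rw [Fin.sum_univ_two]
  exact max_le (le_add_of_nonneg_right (hp1 1)) (le_add_of_nonneg_left (hp1 0))

theorem rayMeasure_apply (δ : ℝ) (κ : Measure (Fin 2 → ℝ)) (s : Fin 2) (t : ℝ) {S : Set ℝ}
    (hS : MeasurableSet S) :
    rayMeasure δ κ s t S =
      ∫⁻ x in Set.Ioi 0, S.indicator (fun _ => 1) x * rayDensity δ κ s t x := by
  rw [rayMeasure, withDensity_apply _ hS, ← lintegral_indicator hS]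
  refine lintegral_congr fun x => ?_
  by_cases h : x ∈ S <;> simp [h]

theorem lintegral_rayMeasure (δ : ℝ) (κ : Measure (Fin 2 → ℝ)) [SFinite κ] (s : Fin 2) (t : ℝ)
    (f : ℝ → ENNReal) (hf : Measurable f) :
    ∫⁻ x, f x ∂(rayMeasure δ κ s t) = ∫⁻ x in Set.Ioi 0, f x * rayDensity δ κ s t x := by
  rw [rayMeasure, lintegral_withDensity_eq_lintegral_mul _
    ((measurable_rayDensity δ κ s).of_uncurry_left (x := t)) hf]
  simp [mul_comm]

/-- The tail of the law along a ray. -/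
theorem rayMeasure_Ici_le {δ : ℝ} (hδ : 0 < δ) (κ : Measure (Fin 2 → ℝ)) [SFinite κ]
    (hκ : ∀ᵐ v ∂κ, 0 ≤ v) (s : Fin 2) {t : ℝ} (ht1 : t < 1) (c : ℝ) :
    rayMeasure δ κ s t (Set.Ici c) ≤
      ENNReal.ofReal ((1 + δ) / δ) * κ {v | c ≤ (1 + δ) * max (v 0) (v 1)} := by
  have hms : MeasurableSet {v : Fin 2 → ℝ | c ≤ (1 + δ) * max (v 0) (v 1)} :=
    measurableSet_le measurable_const (by fun_prop)
  have hm1 : ∀ x, Measurable fun v => squareDensity δ v (ray s t x) := fun x =>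
    (measurable_squareDensity δ).comp (measurable_id.prodMk measurable_const)
  have e1 : rayMeasure δ κ s t (Set.Ici c) = ∫⁻ v, (∫⁻ x in Set.Ioi 0,
      (Set.Ici c).indicator (fun _ => 1) x *
        (ENNReal.ofReal x * squareDensity δ v (ray s t x))) ∂κ := by
    rw [rayMeasure_apply _ _ _ _ measurableSet_Ici, lintegral_lintegral_swap]
    · refine lintegral_congr fun x => ?_
      rw [lintegral_const_mul _ ((hm1 x).const_mul _), lintegral_const_mul _ (hm1 x)]
      rfl
    · refine ((Measurable.indicator measurable_const measurableSet_Ici).comp measurable_snd).mul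
        (measurable_snd.ennreal_ofReal.mul ((measurable_squareDensity δ).comp
          (measurable_fst.prodMk ((measurable_ray s).comp
            (measurable_const.prodMk measurable_snd))))) |>.aemeasurable
  rw [e1, ← setLIntegral_const, ← lintegral_indicator hms]
  refine lintegral_mono_ae ?_
  filter_upwards [hκ] with v hv
  have hvj : ∀ j, 0 ≤ v j := fun j => hv j
  set m := max (v 0) (v 1) with hm
  have hvm : ∀ j, v j ≤ m := by
    intro j; fin_cases j
    · exact le_max_left _ _
    · exact le_max_right _ _
  -- On the ray `x` is the larger coordinate. Within the support it dominates both original values,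
  -- and exceeds the original value of item `s` by at most `δ * m`.
  have supp : ∀ x, 0 < x → squareDensity δ v (ray s t x) ≠ 0 → m ≤ x ∧ x ≤ (1 + δ) * m := by
    intro x hx h
    have h' : ∀ j, v j ≤ ray s t x j ∧ ray s t x j ≤ v j + δ * m := by
      by_contra hne
      exact h (if_neg hne)
    refine ⟨?_, ?_⟩
    · have : ∀ j, v j ≤ x := fun j => (h' j).1.trans (by
        unfold ray; split_ifs
        · exact le_rfl
        · nlinarith)
      exact max_le (this 0) (this 1)
    · have h1 := (h' s).2
      simp only [ray, if_true] at h1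
      linarith [hvm s]
  by_cases hc : c ≤ (1 + δ) * m
  · rw [Set.indicator_of_mem (show v ∈ {v : Fin 2 → ℝ | c ≤ (1 + δ) * max (v 0) (v 1)} from hc)]
    rcases (show 0 ≤ m from (hvj 0).trans (hvm 0)).eq_or_lt with hm0 | hm0
    · rw [setLIntegral_congr_fun (g := fun _ => 0) measurableSet_Ioi, lintegral_zero]
      · exact zero_le
      · intro x hx
        have hx : 0 < x := hx
        have : squareDensity δ v (ray s t x) = 0 := by
          by_contra hne
          have := (supp x hx hne).2
          rw [← hm0] at this
          linarith
        simp [this]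
    -- Jacobian at most `(1 + δ) * m`, density `(δ * m)⁻¹ ^ 2` and an interval of length `δ * m`:
    -- the scale `m` cancels, leaving `(1 + δ) / δ`.
    · calc _ ≤ ∫⁻ x in Set.Ioi 0, (Set.Icc m ((1 + δ) * m)).indicator
            (fun _ => ENNReal.ofReal ((1 + δ) * m) * (ENNReal.ofReal (δ * m))⁻¹ ^ 2) x := by
            refine setLIntegral_mono' measurableSet_Ioi fun x hx => ?_
            have hx : 0 < x := hx
            by_cases hne : squareDensity δ v (ray s t x) = 0
            · simp [hne]
            obtain ⟨s1, s2⟩ := supp x hx hne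
            rw [Set.indicator_of_mem (show x ∈ Set.Icc m ((1 + δ) * m) from ⟨s1, s2⟩)]
            calc _ ≤ 1 * (ENNReal.ofReal x * squareDensity δ v (ray s t x)) := by
                  gcongr
                  exact Set.indicator_le_self' (fun _ _ => zero_le_one) x
              _ ≤ _ := by
                  rw [one_mul]
                  gcongr
                  unfold squareDensity
                  split_ifs
                  · exact le_rfl
                  · exact zero_le
        _ ≤ ∫⁻ x, (Set.Icc m ((1 + δ) * m)).indicator
            (fun _ => ENNReal.ofReal ((1 + δ) * m) * (ENNReal.ofReal (δ * m))⁻¹ ^ 2) x :=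
            setLIntegral_le_lintegral _ _
        _ = ENNReal.ofReal ((1 + δ) / δ) := by
            have hδm : 0 < δ * m := mul_pos hδ hm0
            rw [lintegral_indicator_const measurableSet_Icc, Real.volume_Icc,
              ← ENNReal.ofReal_inv_of_pos hδm, ← ENNReal.ofReal_pow (by positivity),
              ← ENNReal.ofReal_mul (by positivity), ← ENNReal.ofReal_mul (by positivity)]
            congr 1
            field_simp
            ring
  · rw [Set.indicator_of_notMem (show v ∉ {v : Fin 2 → ℝ | c ≤ (1 + δ) * max (v 0) (v 1)} from hc),
      setLIntegral_congr_fun (g := fun _ => 0) measurableSet_Ioi, lintegral_zero]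
    intro x hx
    have hx : 0 < x := hx
    by_cases hne : squareDensity δ v (ray s t x) = 0
    · simp [hne]
    · have : x ∉ Set.Ici c := fun hxc => hc ((show c ≤ x from hxc).trans (supp x hx hne).2)
      simp [this]

theorem isFiniteMeasure_rayMeasure {δ : ℝ} (hδ : 0 < δ) (κ : Measure (Fin 2 → ℝ))
    [IsFiniteMeasure κ] (hκ : ∀ᵐ v ∂κ, 0 ≤ v) (s : Fin 2) {t : ℝ} (ht1 : t < 1) :
    IsFiniteMeasure (rayMeasure δ κ s t) := by
  refine ⟨?_⟩
  have h0 : rayMeasure δ κ s t (Set.Iio 0) = 0 := by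
    rw [rayMeasure_apply _ _ _ _ measurableSet_Iio,
      setLIntegral_congr_fun (g := fun _ => 0) measurableSet_Ioi, lintegral_zero]
    intro x hx
    have : x ∉ Set.Iio (0 : ℝ) := fun h => lt_asymm (show x < 0 from h) hx
    simp [this]
  calc rayMeasure δ κ s t Set.univ ≤ rayMeasure δ κ s t (Set.Iio 0 ∪ Set.Ici 0) := by
        rw [Set.Iio_union_Ici]
    _ ≤ rayMeasure δ κ s t (Set.Iio 0) + rayMeasure δ κ s t (Set.Ici 0) := measure_union_le _ _
    _ < ⊤ := by
        rw [h0, zero_add]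
        exact (rayMeasure_Ici_le hδ κ hκ s ht1 0).trans_lt
          (ENNReal.mul_lt_top ENNReal.ofReal_lt_top (measure_lt_top _ _))

/-- The revenue of a price above `w / (1 + t)` along a ray. -/
theorem ofReal_mul_rayMeasure_le {δ : ℝ} (hδ : 0 < δ) (κ : Measure (Fin 2 → ℝ))
    [IsProbabilityMeasure κ] (hκ : ∀ᵐ v ∂κ, 0 ≤ v) (s : Fin 2) {t : ℝ} (ht0 : 0 < t) (ht1 : t < 1)
    {w q : ℝ} (hw : 0 ≤ w) (hq : w / (1 + t) < q) :
    ENNReal.ofReal (1 + t) * (ENNReal.ofReal q * rayMeasure δ κ s t (Set.Ici q)) ≤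
      ENNReal.ofReal (2 * (1 + δ)) * (ENNReal.ofReal ((1 + δ) / δ) * postedRevenue (smooth δ κ) w +
        ENNReal.ofReal w * rayMeasure δ κ s t (Set.Ioi (w / (1 + t)))) := by
  have := isProbabilityMeasure_smooth hδ κ
  have h1t : 0 < 1 + t := by linarith
  have h2δ : 0 < 2 * (1 + δ) := by linarith
  have hq0 : 0 < q := (div_nonneg hw h1t.le).trans_lt hq
  rw [← mul_assoc, ← ENNReal.ofReal_mul h1t.le]
  -- The bundle price `Q` is `(1 + t) * q` reduced by `2 * (1 + δ)`: the factor `2` absorbs `1 + t`,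
  -- and `1 + δ` absorbs the growth of the maximum. If `Q` is still above `w`, it is an admissible
  -- posted price; otherwise `(1 + t) * q` is at most a constant times `w`.
  rcases lt_or_ge (2 * (1 + δ) * w) ((1 + t) * q) with h | h
  · set Q := (1 + t) * q / (2 * (1 + δ)) with hQ
    have hwQ : w < Q := by rw [hQ, lt_div_iff₀ h2δ]; linarith
    have hQe : (1 + t) * q = 2 * (1 + δ) * Q := by rw [hQ]; field_simp
    calc ENNReal.ofReal ((1 + t) * q) * rayMeasure δ κ s t (Set.Ici q)
        ≤ ENNReal.ofReal ((1 + t) * q) * (ENNReal.ofReal ((1 + δ) / δ) *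
            smooth δ κ {z | Q ≤ ∑ j, z j}) := by
          refine mul_le_mul_right ((rayMeasure_Ici_le hδ κ hκ s ht1 q).trans
            (mul_le_mul_right ?_ _)) _
          refine (measure_mono fun v hv => ?_).trans (measure_max_le_measure_sum hδ κ hκ Q)
          simp only [Set.mem_ofPred_eq] at hv ⊢
          rw [hQ, div_le_iff₀ h2δ]
          nlinarith
      _ = ENNReal.ofReal (2 * (1 + δ)) * (ENNReal.ofReal ((1 + δ) / δ) *
            (ENNReal.ofReal Q * smooth δ κ {z | Q ≤ ∑ j, z j})) := by
          rw [hQe, ENNReal.ofReal_mul h2δ.le]; ring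
      _ ≤ _ := by
          gcongr
          exact le_add_right (mul_le_mul_right (ofReal_mul_measure_le_postedRevenue _ hwQ) _)
  · calc ENNReal.ofReal ((1 + t) * q) * rayMeasure δ κ s t (Set.Ici q)
        ≤ ENNReal.ofReal (2 * (1 + δ) * w) * rayMeasure δ κ s t (Set.Ioi (w / (1 + t))) := by
          exact mul_le_mul' (ENNReal.ofReal_le_ofReal h)
            (measure_mono fun x hx => hq.trans_le hx)
      _ = ENNReal.ofReal (2 * (1 + δ)) *
            (ENNReal.ofReal w * rayMeasure δ κ s t (Set.Ioi (w / (1 + t)))) := by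
          rw [ENNReal.ofReal_mul h2δ.le, mul_assoc]
      _ ≤ _ := by
          gcongr
          exact le_add_self

/-! ### The revenue from one perturbed buyer -/

theorem measurable_postedRevenue (K : Measure (Fin 2 → ℝ)) : Measurable (postedRevenue K) :=
  Measurable.iSup fun _ => Measurable.ite (measurableSet_lt measurable_id measurable_const)
    measurable_const measurable_const

theorem measurable_rayMeasure_Ioi {Ω : Type*} [MeasurableSpace Ω] (δ : ℝ)
    (κ : Measure (Fin 2 → ℝ)) [SFinite κ] (s : Fin 2) (w : Ω → ℝ) (hw : Measurable w) :
    Measurable (Function.uncurry fun (t : ℝ) (ω : Ω) =>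
      rayMeasure δ κ s t (Set.Ioi (w ω / (1 + t)))) := by
  unfold Function.uncurry
  simp_rw [rayMeasure_apply δ κ s _ measurableSet_Ioi]
  refine Measurable.lintegral_prod_right (Measurable.mul ?_ ?_)
  · have : MeasurableSet {p : (ℝ × Ω) × ℝ | w p.1.2 / (1 + p.1.1) < p.2} :=
      measurableSet_lt (by fun_prop) (by fun_prop)
    exact measurable_const.indicator this
  · exact (measurable_rayDensity δ κ s).comp
      (by fun_prop : Measurable fun p : (ℝ × Ω) × ℝ => (p.1.1, p.2))

/-- Integrating over all rays the mass above a hyperplane gives the mass above that hyperplane. -/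
theorem sum_lintegral_rayMeasure_Ioi {δ : ℝ} (hδ : 0 < δ) (κ : Measure (Fin 2 → ℝ)) [SFinite κ]
    (hκ : ∀ᵐ v ∂κ, 0 ≤ v) {w : ℝ} (hw : 0 ≤ w) :
    ∑ s, ∫⁻ t in Set.Ioo 0 1, rayMeasure δ κ s t (Set.Ioi (w / (1 + t))) =
      smooth δ κ {z | w < ∑ j, z j} := by
  have hS : MeasurableSet {z : Fin 2 → ℝ | w < ∑ j, z j} :=
    measurableSet_lt measurable_const (by fun_prop)
  rw [← lintegral_indicator_one hS, lintegral_smooth_eq_rays hδ κ hκ _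
    (measurable_one.indicator hS) (by simp [hw])]
  refine Finset.sum_congr rfl fun s _ => setLIntegral_congr_fun measurableSet_Ioo fun t ht => ?_
  rw [rayMeasure_apply δ κ s _ measurableSet_Ioi]
  refine lintegral_congr fun x => ?_
  have h1t : 0 < 1 + t := by linarith [ht.1]
  congr 1
  simp only [Set.indicator, Set.mem_Ioi, Set.mem_ofPred_eq, sum_ray, div_lt_iff₀ h1t, Pi.one_apply]

/-- The revenue from a single buyer with perturbed values, in a mechanism `(x, P)` that is incentive
compatible and individually rational in expectation over the state `ω` of the world: types below the
threshold `w ω` pay at most the value they obtain, and the rest of the revenue is within a constant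
of that of a posted price for the grand bundle above the threshold. -/
theorem lintegral_buyer_payment_le {Ω : Type*} [MeasurableSpace Ω] (μ : Measure Ω)
    [IsProbabilityMeasure μ] {δ : ℝ} (hδ : 0 < δ) (κ : Measure (Fin 2 → ℝ))
    [IsProbabilityMeasure κ] (hκ : ∀ᵐ v ∂κ, 0 ≤ v)
    (x : (Fin 2 → ℝ) → Ω → Fin 2 → ℝ) (hx : Measurable (Function.uncurry x))
    (hx01 : ∀ z, 0 ≤ z → ∀ᵐ ω ∂μ, ∀ j, 0 ≤ x z ω j ∧ x z ω j ≤ 1)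
    (P : (Fin 2 → ℝ) → ℝ) (hP : Measurable P)
    (hIC : ∀ z y, 0 ≤ z → 0 ≤ y →
      ∫ ω, ∑ j, z j * x y ω j ∂μ - P y ≤ ∫ ω, ∑ j, z j * x z ω j ∂μ - P z)
    (hIR : ∀ z, 0 ≤ z → P z ≤ ∫ ω, ∑ j, z j * x z ω j ∂μ)
    (w : Ω → ℝ) (hw : Measurable w) (hw0 : ∀ᵐ ω ∂μ, 0 ≤ w ω) :
    ∫⁻ z, ENNReal.ofReal (P z) ∂(smooth δ κ) ≤
      (∫⁻ ω, ∫⁻ z, (if ∑ j, z j < w ω then ENNReal.ofReal (∑ j, z j * x z ω j) else 0)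
        ∂(smooth δ κ) ∂μ) +
        ENNReal.ofReal (6 * (1 + δ) ^ 2 / δ) * ∫⁻ ω, postedRevenue (smooth δ κ) (w ω) ∂μ := by
  have := isProbabilityMeasure_smooth hδ κ
  set V : Ω → ENNReal := fun ω => postedRevenue (smooth δ κ) (w ω) with hV
  have hVm : Measurable V := (measurable_postedRevenue _).comp hw
  set A : Fin 2 → ℝ → Ω → ENNReal := fun s t ω =>
    ENNReal.ofReal (w ω) * rayMeasure δ κ s t (Set.Ioi (w ω / (1 + t))) with hA
  have hAm : ∀ s, Measurable (Function.uncurry (A s)) := fun s =>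
    ((hw.comp measurable_snd).ennreal_ofReal).mul (measurable_rayMeasure_Ioi δ κ s w hw)
  set L : (Fin 2 → ℝ) → Ω → ENNReal := fun z ω =>
    if ∑ j, z j < w ω then ENNReal.ofReal (∑ j, z j * x z ω j) else 0 with hL
  have hLm : Measurable (Function.uncurry L) := by
    refine Measurable.ite (measurableSet_lt (by fun_prop) (hw.comp measurable_snd)) ?_
      measurable_const
    refine Measurable.ennreal_ofReal (Finset.measurable_fun_sum _ fun j _ => ?_)
    exact (by fun_prop : Measurable fun p : (Fin 2 → ℝ) × Ω => p.1 j).mul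
      ((measurable_pi_apply j).comp hx)
  -- the bound along each ray
  have hray : ∀ s, ∀ t ∈ Set.Ioo (0 : ℝ) 1,
      ∫⁻ r in Set.Ioi 0, ENNReal.ofReal (P (ray s t r)) * rayDensity δ κ s t r ≤
        (∫⁻ ω, (∫⁻ r in Set.Ioi 0, L (ray s t r) ω * rayDensity δ κ s t r) ∂μ) +
          ENNReal.ofReal (2 * (1 + δ)) *
            (ENNReal.ofReal ((1 + δ) / δ) * (∫⁻ ω, V ω ∂μ) + ∫⁻ ω, A s t ω ∂μ) := by
    intro s t ht
    have h1t : 0 < 1 + t := by linarith [ht.1]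
    have hrm : Measurable (ray s t) := (measurable_ray s).comp measurable_prodMk_left
    have hfin := isFiniteMeasure_rayMeasure hδ κ hκ s ht.2
    have hr0 : ∀ r, 0 ≤ r → 0 ≤ ray s t r := by
      intro r hr j
      simp only [ray]
      split_ifs
      · exact hr
      · exact mul_nonneg ht.1.le hr
    have hr1 : ∀ r j, ray s t r j = r * ray s t 1 j := by
      intro r j
      simp only [ray]
      split_ifs <;> ring
    set g : ℝ → Ω → ℝ := fun r ω => ∑ j, ray s t 1 j * x (ray s t r) ω j with hg
    have hgr : ∀ a r ω, ∑ j, ray s t a j * x (ray s t r) ω j = a * g r ω := by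
      intro a r ω
      rw [hg, Finset.mul_sum]
      exact Finset.sum_congr rfl fun j _ => by rw [hr1 a j]; ring
    have hxr : Measurable fun p : ℝ × Ω => x (ray s t p.1) p.2 :=
      hx.comp ((hrm.comp measurable_fst).prodMk measurable_snd)
    have hgm : Measurable (Function.uncurry g) :=
      Finset.measurable_fun_sum _ fun j _ => ((measurable_pi_apply j).comp hxr).const_mul _
    have hsum1 : ∑ j, ray s t 1 j = 1 + t := by rw [sum_ray, one_mul]
    have key := lintegral_payment_le μ (rayMeasure δ κ s t)
      ((withDensity_absolutelyContinuous _ _).trans Measure.restrict_le_self.absolutelyContinuous)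
      (by
        rw [rayMeasure_apply _ _ _ _ measurableSet_Iio,
          setLIntegral_congr_fun (g := fun _ => 0) measurableSet_Ioi, lintegral_zero]
        intro x hx
        have : x ∉ Set.Iio (0 : ℝ) := fun h => lt_asymm (show x < 0 from h) hx
        simp [this])
      g hgm (1 + t)
      (by
        intro r hr
        filter_upwards [hx01 _ (hr0 r hr)] with ω hω
        have h1 : ∀ j, 0 ≤ ray s t 1 j := fun j => hr0 1 zero_le_one j
        refine ⟨Finset.sum_nonneg fun j _ => mul_nonneg (h1 j) (hω j).1, ?_⟩
        rw [← hsum1]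
        exact Finset.sum_le_sum fun j _ => mul_le_of_le_one_right (h1 j) (hω j).2)
      (fun r => P (ray s t r))
      (by
        intro a b ha hb
        have := hIC _ _ (hr0 a ha) (hr0 b hb)
        simp only [hgr, integral_const_mul] at this
        exact this)
      (by
        intro a ha
        have := hIR _ (hr0 a ha)
        simp only [hgr, integral_const_mul] at this
        exact this)
      -- A bundle value below `w ω` means a coordinate `x` below `w ω / (1 + t)`. The inverse of `1
      -- + t` in the revenue bound cancels the maximal slope `c = 1 + t`.
      (fun ω => w ω / (1 + t)) (hw.div_const _)
      (fun ω => (ENNReal.ofReal (1 + t))⁻¹ * (ENNReal.ofReal (2 * (1 + δ)) *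
        (ENNReal.ofReal ((1 + δ) / δ) * V ω + A s t ω)))
      (by
        filter_upwards [hw0] with ω hω
        refine ⟨div_nonneg hω h1t.le, fun q hq => ?_⟩
        rw [mul_comm (ENNReal.ofReal (1 + t))⁻¹, ← div_eq_mul_inv, ENNReal.le_div_iff_mul_le
          (Or.inl (by simpa using h1t)) (Or.inl ENNReal.ofReal_ne_top),
          mul_comm _ (ENNReal.ofReal (1 + t))]
        exact ofReal_mul_rayMeasure_le hδ κ hκ s ht.1 ht.2 hω hq)
    have hAm' : Measurable fun ω => A s t ω := (hAm s).of_uncurry_left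
    have hBm' : Measurable fun ω => ENNReal.ofReal ((1 + δ) / δ) * V ω + A s t ω :=
      (hVm.const_mul _).add hAm'
    have hBm : Measurable fun ω => ENNReal.ofReal (2 * (1 + δ)) *
        (ENNReal.ofReal ((1 + δ) / δ) * V ω + A s t ω) := hBm'.const_mul _
    rw [lintegral_const_mul _ hBm, ← mul_assoc, ENNReal.mul_inv_cancel (by simpa using h1t)
      ENNReal.ofReal_ne_top, one_mul, lintegral_const_mul _ hBm', lintegral_add_left (hVm.const_mul _),
      lintegral_const_mul _ hVm, lintegral_rayMeasure δ κ s t (fun r => ENNReal.ofReal (P (ray s t r)))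
        (hP.comp hrm).ennreal_ofReal] at key
    refine key.trans (add_le_add (le_of_eq ?_) le_rfl)
    refine lintegral_congr fun ω => ?_
    rw [← lintegral_rayMeasure _ _ _ _ (fun r => L (ray s t r) ω)
      (hLm.comp (hrm.prodMk measurable_const))]
    refine lintegral_congr fun r => ?_
    simp only [hL, sum_ray, hgr, lt_div_iff₀ h1t]
  -- By individual rationality the zero type pays nothing positive, so the atom at the origin, which
  -- the rays miss, may be dropped.
  have hP0 : P 0 ≤ 0 := by simpa using hIR 0 le_rfl
  have hLr : ∀ s, Measurable fun p : (ℝ × Ω) × ℝ =>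
      L (ray s p.1.1 p.2) p.1.2 * rayDensity δ κ s p.1.1 p.2 := by
    intro s
    have h1 : Measurable fun p : (ℝ × Ω) × ℝ => (p.1.1, p.2) := by fun_prop
    exact (hLm.comp (((measurable_ray s).comp h1).prodMk measurable_fst.snd)).mul
      ((measurable_rayDensity δ κ s).comp h1)
  have hLω : ∫⁻ ω, ∫⁻ z, L z ω ∂(smooth δ κ) ∂μ =
      ∑ s, ∫⁻ t in Set.Ioo 0 1, ∫⁻ ω, (∫⁻ r in Set.Ioi 0,
        L (ray s t r) ω * rayDensity δ κ s t r) ∂μ := by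
    have e : ∀ ω, ∫⁻ z, L z ω ∂(smooth δ κ) = ∑ s, ∫⁻ t in Set.Ioo 0 1, ∫⁻ r in Set.Ioi 0,
        L (ray s t r) ω * rayDensity δ κ s t r := fun ω =>
      lintegral_smooth_eq_rays hδ κ hκ (fun z => L z ω) hLm.of_uncurry_right (by simp [hL])
    simp_rw [e]
    have hm : ∀ s, Measurable fun p : Ω × ℝ =>
        ∫⁻ r in Set.Ioi 0, L (ray s p.2 r) p.1 * rayDensity δ κ s p.2 r := fun s =>
      Measurable.lintegral_prod_right ((hLr s).comp
        (by fun_prop : Measurable fun p : (Ω × ℝ) × ℝ => ((p.1.2, p.1.1), p.2)))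
    rw [lintegral_finsetSum _ fun s _ => Measurable.lintegral_prod_right (hm s)]
    refine Finset.sum_congr rfl fun s _ => ?_
    exact lintegral_lintegral_swap (hm s).aemeasurable
  -- The terms for prices near the threshold are summed over all rays before being compared with
  -- `V`; they cost one `V` in total, with no factor `1 / δ`.
  have hAω : ∑ s, ∫⁻ t in Set.Ioo 0 1, ∫⁻ ω, A s t ω ∂μ ≤ ∫⁻ ω, V ω ∂μ := by
    simp_rw [fun s => lintegral_lintegral_swap (μ := volume.restrict (Set.Ioo (0 : ℝ) 1)) (ν := μ)
      (hAm s).aemeasurable]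
    have hAs : ∀ s, Measurable fun ω => ∫⁻ t in Set.Ioo (0 : ℝ) 1, A s t ω := fun s =>
      Measurable.lintegral_prod_left (hAm s)
    rw [← lintegral_finsetSum _ fun s _ => hAs s]
    refine lintegral_mono_ae ?_
    filter_upwards [hw0] with ω hω
    have hm : ∀ s, Measurable fun t => rayMeasure δ κ s t (Set.Ioi (w ω / (1 + t))) := fun s => by
      have h := measurable_rayMeasure_Ioi δ κ s w hw
      exact h.of_uncurry_right (y := ω)
    have e : ∀ s, ∫⁻ t in Set.Ioo (0 : ℝ) 1, A s t ω = ENNReal.ofReal (w ω) *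
        ∫⁻ t in Set.Ioo (0 : ℝ) 1, rayMeasure δ κ s t (Set.Ioi (w ω / (1 + t))) := fun s =>
      lintegral_const_mul _ (hm s)
    rw [Finset.sum_congr rfl fun s _ => e s, ← Finset.mul_sum,
      sum_lintegral_rayMeasure_Ioi hδ κ hκ hω]
    exact ofReal_mul_measure_lt_le_postedRevenue _ _
  have hAt : ∀ s, Measurable fun t => ∫⁻ ω, A s t ω ∂μ := fun s =>
    Measurable.lintegral_prod_right (hAm s)
  have hLt : ∀ s, Measurable fun t => ∫⁻ ω, (∫⁻ r in Set.Ioi 0,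
      L (ray s t r) ω * rayDensity δ κ s t r) ∂μ := fun s =>
    Measurable.lintegral_prod_right (Measurable.lintegral_prod_right (hLr s))
  set C := ENNReal.ofReal ((1 + δ) / δ) * ∫⁻ ω, V ω ∂μ with hC
  calc ∫⁻ z, ENNReal.ofReal (P z) ∂(smooth δ κ)
      = ∑ s, ∫⁻ t in Set.Ioo 0 1, ∫⁻ r in Set.Ioi 0,
          ENNReal.ofReal (P (ray s t r)) * rayDensity δ κ s t r :=
        lintegral_smooth_eq_rays hδ κ hκ _ hP.ennreal_ofReal (ENNReal.ofReal_of_nonpos hP0)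
    _ ≤ ∑ s, ∫⁻ t in Set.Ioo (0 : ℝ) 1, ((∫⁻ ω, (∫⁻ r in Set.Ioi 0,
          L (ray s t r) ω * rayDensity δ κ s t r) ∂μ) +
            ENNReal.ofReal (2 * (1 + δ)) * (C + ∫⁻ ω, A s t ω ∂μ)) :=
        Finset.sum_le_sum fun s _ => setLIntegral_mono' measurableSet_Ioo fun t ht => hray s t ht
    _ = (∑ s, ∫⁻ t in Set.Ioo 0 1, ∫⁻ ω, (∫⁻ r in Set.Ioi 0,
          L (ray s t r) ω * rayDensity δ κ s t r) ∂μ) +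
            ENNReal.ofReal (2 * (1 + δ)) *
              (2 * C + ∑ s, ∫⁻ t in Set.Ioo 0 1, ∫⁻ ω, A s t ω ∂μ) := by
        have e : ∀ s, ∫⁻ t in Set.Ioo (0 : ℝ) 1, ((∫⁻ ω, (∫⁻ r in Set.Ioi 0,
            L (ray s t r) ω * rayDensity δ κ s t r) ∂μ) +
            ENNReal.ofReal (2 * (1 + δ)) * (C + ∫⁻ ω, A s t ω ∂μ)) =
            (∫⁻ t in Set.Ioo (0 : ℝ) 1, ∫⁻ ω, (∫⁻ r in Set.Ioi 0,
              L (ray s t r) ω * rayDensity δ κ s t r) ∂μ) +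
            ENNReal.ofReal (2 * (1 + δ)) *
              (C + ∫⁻ t in Set.Ioo (0 : ℝ) 1, ∫⁻ ω, A s t ω ∂μ) := by
          intro s
          rw [lintegral_add_left (hLt s), lintegral_const_mul _ ((hAt s).const_add _),
            lintegral_add_left measurable_const]
          simp
        rw [Finset.sum_congr rfl fun s _ => e s, Finset.sum_add_distrib, ← Finset.mul_sum,
          Finset.sum_add_distrib]
        simp
    _ ≤ (∫⁻ ω, ∫⁻ z, L z ω ∂(smooth δ κ) ∂μ) +
          ENNReal.ofReal (2 * (1 + δ)) * (2 * C + ∫⁻ ω, V ω ∂μ) := by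
        rw [← hLω]
        gcongr
    _ ≤ _ := by
        refine add_le_add le_rfl ?_
        -- The factor `2` counts the two families of rays, each with slopes in an interval of length
        -- one.
        have : 2 * C + ∫⁻ ω, V ω ∂μ = ENNReal.ofReal (2 * ((1 + δ) / δ) + 1) * ∫⁻ ω, V ω ∂μ := by
          rw [ENNReal.ofReal_add (by positivity) zero_le_one, ENNReal.ofReal_mul (by norm_num), hC]
          simp [add_mul, mul_assoc]
        rw [this, ← mul_assoc, ← ENNReal.ofReal_mul (by positivity)]
        gcongr
        rw [le_div_iff₀ hδ]
        have : (2 * ((1 + δ) / δ) + 1) * δ = 2 + 3 * δ := by field_simp; ring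
        calc 2 * (1 + δ) * (2 * ((1 + δ) / δ) + 1) * δ
            = 2 * (1 + δ) * ((2 * ((1 + δ) / δ) + 1) * δ) := by ring
          _ = 2 * (1 + δ) * (2 + 3 * δ) := by rw [this]
          _ ≤ _ := by nlinarith

/-! ### Separating one buyer from the others -/

/-- The values of the buyers other than `i`. -/
abbrev Others (n : ℕ) (i : Fin n) : Type := {j : Fin n // j ≠ i} → Fin 2 → ℝ

variable {n : ℕ}

def rest (i : Fin n) (v : Profile n) : Others n i := fun j => v j.1

def glue (i : Fin n) (z : Fin 2 → ℝ) (a : Others n i) : Profile n :=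
  fun j => if h : j = i then z else a ⟨j, h⟩

theorem glue_self (i : Fin n) (z : Fin 2 → ℝ) (a : Others n i) : glue i z a i = z := by
  simp [glue]

theorem glue_of_ne {i j : Fin n} (h : j ≠ i) (z : Fin 2 → ℝ) (a : Others n i) :
    glue i z a j = a ⟨j, h⟩ := by
  simp [glue, h]

theorem rest_glue (i : Fin n) (z : Fin 2 → ℝ) (a : Others n i) : rest i (glue i z a) = a := by
  funext j
  exact glue_of_ne j.2 z a

theorem update_eq_glue (i : Fin n) (v : Profile n) (z : Fin 2 → ℝ) :
    Function.update v i z = glue i z (rest i v) := by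
  funext j
  by_cases h : j = i
  · subst h; simp [glue_self]
  · rw [Function.update_of_ne h, glue_of_ne h]; rfl

theorem update_glue (i : Fin n) (z b : Fin 2 → ℝ) (a : Others n i) :
    Function.update (glue i z a) i b = glue i b a := by
  rw [update_eq_glue, rest_glue]

theorem glue_nonneg {i : Fin n} {z : Fin 2 → ℝ} {a : Others n i} (hz : 0 ≤ z) (ha : 0 ≤ a) :
    0 ≤ glue i z a := by
  intro j
  by_cases h : j = i
  · subst h; rw [glue_self]; exact hz
  · rw [glue_of_ne h]; exact ha _

theorem measurable_rest (i : Fin n) : Measurable (rest i) :=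
  measurable_pi_lambda _ fun j => measurable_pi_apply j.1

theorem measurable_glue (i : Fin n) :
    Measurable fun p : (Fin 2 → ℝ) × Others n i => glue i p.1 p.2 := by
  refine measurable_pi_lambda _ fun j => ?_
  by_cases h : j = i
  · subst h; simp only [glue_self]; exact measurable_fst
  · simp only [glue_of_ne h]; exact (measurable_pi_apply _).comp measurable_snd

theorem measurable_shift : Measurable fun p : Profile n × Profile n => shift p.1 p.2 := by
  unfold shift
  refine measurable_pi_lambda _ fun i => measurable_pi_lambda _ fun j => ?_
  fun_prop

theorem isProbabilityMeasure_noise {δ : ℝ} (hδ : 0 < δ) : IsProbabilityMeasure (noise n δ) := by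
  have := isProbabilityMeasure_buyerNoise hδ
  have h : noise n δ = Measure.pi fun _ : Fin n => buyerNoise δ := rfl
  rw [h]; infer_instance

theorem isProbabilityMeasure_squareShift {δ : ℝ} (hδ : 0 < δ) (D : Measure (Profile n))
    [IsProbabilityMeasure D] : IsProbabilityMeasure (squareShift δ D) := by
  have := isProbabilityMeasure_noise (n := n) hδ
  exact Measure.isProbabilityMeasure_map measurable_shift.aemeasurable

/-- Resampling one coordinate does not change a product measure. -/
theorem map_update_pi_prod {ι : Type*} [Fintype ι] [DecidableEq ι] {α : Type*} [MeasurableSpace α]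
    (μ : Measure α) [IsProbabilityMeasure μ] (i : ι) :
    ((Measure.pi fun _ : ι => μ).prod μ).map (fun p => Function.update p.1 i p.2) =
      Measure.pi fun _ : ι => μ := by
  have hm : Measurable fun p : (ι → α) × α => Function.update p.1 i p.2 := by
    refine measurable_pi_lambda _ fun j => ?_
    by_cases h : j = i
    · subst h; simp only [Function.update_self]; exact measurable_snd
    · simp only [Function.update_of_ne h]; exact (measurable_pi_apply j).comp measurable_fst
  refine (Measure.pi_eq fun s hs => ?_).symm
  rw [Measure.map_apply hm (MeasurableSet.univ_pi hs)]
  have : (fun p : (ι → α) × α => Function.update p.1 i p.2) ⁻¹' Set.univ.pi s =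
      (Set.univ.pi (Function.update s i Set.univ)) ×ˢ s i := by
    ext p
    simp only [Set.mem_preimage, Set.mem_univ_pi, Set.mem_prod]
    constructor
    · refine fun h => ⟨fun j => ?_, by simpa using h i⟩
      by_cases hj : j = i
      · subst hj; simp
      · simpa [Function.update_of_ne hj] using h j
    · rintro ⟨h1, h2⟩ j
      by_cases hj : j = i
      · subst hj; simpa using h2
      · simpa [Function.update_of_ne hj] using h1 j
  rw [this, Measure.prod_prod, Measure.pi_pi, ← Finset.mul_prod_erase _ _ (Finset.mem_univ i),
    ← Finset.mul_prod_erase _ (fun j => μ (s j)) (Finset.mem_univ i), Function.update_self,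
    measure_univ, one_mul, mul_comm]
  congr 1
  exact Finset.prod_congr rfl fun j hj => by rw [Function.update_of_ne (Finset.ne_of_mem_erase hj)]

theorem shift_update (i : Fin n) (v ε : Profile n) (e : Fin 2 → ℝ) :
    shift v (Function.update ε i e) = glue i (bump (v i) e) (rest i (shift v ε)) := by
  funext j
  by_cases h : j = i
  · subst h; rw [glue_self]; funext k; simp [shift, bump]
  · rw [glue_of_ne h]; funext k; simp [shift, rest, Function.update_of_ne h]

/-- The noise of buyer `i` is independent of everything else, so it can be redrawn after the
perturbed reports of the others and her own unperturbed values are known. -/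
theorem lintegral_squareShift {δ : ℝ} (hδ : 0 < δ) (D : Measure (Profile n))
    [IsProbabilityMeasure D] (i : Fin n) (ψ : Profile n → ENNReal) (hψ : Measurable ψ) :
    ∫⁻ v, ψ v ∂(squareShift δ D) = ∫⁻ p, ∫⁻ e, ψ (glue i (bump p.2 e) p.1) ∂(buyerNoise δ)
      ∂((D.prod (noise n δ)).map fun p => (rest i (shift p.1 p.2), p.1 i)) := by
  have := isProbabilityMeasure_buyerNoise hδ
  have := isProbabilityMeasure_noise (n := n) hδ
  have hup : Measurable fun p : Profile n × (Fin 2 → ℝ) => Function.update p.1 i p.2 := by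
    simp only [update_eq_glue]
    exact (measurable_glue i).comp (measurable_snd.prodMk ((measurable_rest i).comp measurable_fst))
  have h2 : Measurable fun p : Profile n × Profile n => (rest i (shift p.1 p.2), p.1 i) :=
    ((measurable_rest i).comp measurable_shift).prodMk
      ((measurable_pi_apply i).comp measurable_fst)
  have h3 : Measurable fun q : (Others n i × (Fin 2 → ℝ)) × (Fin 2 → ℝ) =>
      glue i (bump q.1.2 q.2) q.1.1 :=
    (measurable_glue i).comp ((measurable_bump.comp
      (measurable_fst.snd.prodMk measurable_snd)).prodMk measurable_fst.fst)
  have h4 : Measurable fun p : Others n i × (Fin 2 → ℝ) =>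
      ∫⁻ e, ψ (glue i (bump p.2 e) p.1) ∂(buyerNoise δ) := (hψ.comp h3).lintegral_prod_right'
  have h5 : Measurable fun p : Profile n × Profile n => ψ (shift p.1 p.2) :=
    hψ.comp measurable_shift
  have h6 : Measurable fun p : Profile n × Profile n =>
      ∫⁻ e, ψ (glue i (bump (p.1 i) e) (rest i (shift p.1 p.2))) ∂(buyerNoise δ) := h4.comp h2
  rw [squareShift, lintegral_map hψ measurable_shift, lintegral_map h4 h2,
    lintegral_prod _ h5.aemeasurable, lintegral_prod _ h6.aemeasurable]
  refine lintegral_congr fun v => ?_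
  have hn : noise n δ = ((noise n δ).prod (buyerNoise δ)).map fun p => Function.update p.1 i p.2 :=
    (map_update_pi_prod (buyerNoise δ) i).symm
  have hs : Measurable fun ε => ψ (shift v ε) :=
    hψ.comp (measurable_shift.comp measurable_prodMk_left)
  conv_lhs => rw [hn]
  have hsu : Measurable fun p : Profile n × (Fin 2 → ℝ) =>
      ψ (shift v (Function.update p.1 i p.2)) := hs.comp hup
  rw [lintegral_map hs hup, lintegral_prod _ hsu.aemeasurable]
  simp only [shift_update]

/-- A disintegration of the smoothed distribution: given the reports of the other buyers, the values
of buyer `i` have law `smooth δ (κ a)`. -/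
def Disintegrates (δ : ℝ) (D : Measure (Profile n)) (i : Fin n)
    (κ : Kernel (Others n i) (Fin 2 → ℝ)) : Prop :=
  (∀ᵐ a ∂((squareShift δ D).map (rest i)), ∀ᵐ v ∂(κ a), 0 ≤ v) ∧
  ∀ ψ : Profile n → ENNReal, Measurable ψ → ∫⁻ v, ψ v ∂(squareShift δ D) =
    ∫⁻ a, ∫⁻ z, ψ (glue i z a) ∂(smooth δ (κ a)) ∂((squareShift δ D).map (rest i))

/-- Only the unperturbed values of buyer `i` need conditioning on the other reports; the fresh noise
then makes her conditional law of the form `smooth δ (κ a)`. -/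
theorem disintegrates_of_compProd {δ : ℝ} (hδ : 0 < δ) (D : Measure (Profile n))
    [IsProbabilityMeasure D] (hD : ∀ᵐ v ∂D, 0 ≤ v) (i : Fin n)
    (κ : Kernel (Others n i) (Fin 2 → ℝ)) [IsMarkovKernel κ]
    (h : ((squareShift δ D).map (rest i)).compProd κ =
      (D.prod (noise n δ)).map fun p => (rest i (shift p.1 p.2), p.1 i)) :
    Disintegrates δ D i κ := by
  have := isProbabilityMeasure_buyerNoise hδ
  have := isProbabilityMeasure_noise (n := n) hδ
  have := isProbabilityMeasure_squareShift hδ D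
  have hprob : IsProbabilityMeasure ((squareShift δ D).map (rest i)) :=
    Measure.isProbabilityMeasure_map (measurable_rest i).aemeasurable
  have h2 : Measurable fun p : Profile n × Profile n => (rest i (shift p.1 p.2), p.1 i) :=
    ((measurable_rest i).comp measurable_shift).prodMk
      ((measurable_pi_apply i).comp measurable_fst)
  have h3 : Measurable fun q : (Others n i × (Fin 2 → ℝ)) × (Fin 2 → ℝ) =>
      glue i (bump q.1.2 q.2) q.1.1 :=
    (measurable_glue i).comp ((measurable_bump.comp
      (measurable_fst.snd.prodMk measurable_snd)).prodMk measurable_fst.fst)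
  refine ⟨?_, fun ψ hψ => ?_⟩
  · refine Measure.ae_ae_of_ae_compProd (p := fun q => 0 ≤ q.2) ?_
    rw [h, ae_map_iff h2.aemeasurable (measurableSet_le measurable_const measurable_snd)]
    have a1 : ∀ᵐ p ∂(D.prod (noise n δ)), 0 ≤ p.1 := Measure.quasiMeasurePreserving_fst.ae hD
    filter_upwards [a1] with p hp using hp i
  · have h4 : Measurable fun p : Others n i × (Fin 2 → ℝ) =>
        ∫⁻ e, ψ (glue i (bump p.2 e) p.1) ∂(buyerNoise δ) := (hψ.comp h3).lintegral_prod_right'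
    rw [lintegral_squareShift hδ D i ψ hψ, ← h, Measure.lintegral_compProd h4]
    refine lintegral_congr fun a => ?_
    rw [lintegral_smooth δ (κ a) hδ (fun z => ψ (glue i z a))
      (hψ.comp ((measurable_glue i).comp measurable_prodMk_right))]

theorem fst_map_rest_shift (δ : ℝ) (D : Measure (Profile n)) (i : Fin n) :
    ((D.prod (noise n δ)).map fun p => (rest i (shift p.1 p.2), p.1 i)).fst =
      (squareShift δ D).map (rest i) := by
  have h1 : Measurable fun p : Profile n × Profile n => rest i (shift p.1 p.2) :=
    (measurable_rest i).comp measurable_shift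
  rw [Measure.fst_map_prodMk₀, squareShift, Measure.map_map (measurable_rest i) measurable_shift]
  · rfl
  · exact ((measurable_pi_apply i).comp measurable_fst).aemeasurable

theorem exists_disintegrates {δ : ℝ} (hδ : 0 < δ) (D : Measure (Profile n))
    [IsProbabilityMeasure D] (hD : ∀ᵐ v ∂D, 0 ≤ v) (i : Fin n) :
    ∃ κ : Kernel (Others n i) (Fin 2 → ℝ), IsMarkovKernel κ ∧ Disintegrates δ D i κ := by
  have := isProbabilityMeasure_noise (n := n) hδ
  set ν := (D.prod (noise n δ)).map fun p => (rest i (shift p.1 p.2), p.1 i)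
  refine ⟨ν.condKernel, inferInstance, disintegrates_of_compProd hδ D hD i _ ?_⟩
  rw [← fst_map_rest_shift]
  exact ν.disintegrate ν.condKernel

/-- When buyers are independent, the perturbed reports of the others are a function of their own
values and of independent noise, so they say nothing about buyer `i` and the kernel can be constant.
-/
theorem disintegrates_const {δ : ℝ} (hδ : 0 < δ) (D : Measure (Profile n))
    [IsProbabilityMeasure D] (hD : ∀ᵐ v ∂D, 0 ≤ v)
    (hind : iIndepFun (fun (i : Fin n) (v : Profile n) => v i) D) (i : Fin n) :
    Disintegrates δ D i (Kernel.const _ (D.map fun v => v i)) := by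
  have := isProbabilityMeasure_noise (n := n) hδ
  have hev : Measurable fun v : Profile n => v i := measurable_pi_apply i
  have hDi : IsProbabilityMeasure (D.map fun v => v i) :=
    Measure.isProbabilityMeasure_map hev.aemeasurable
  have := isProbabilityMeasure_squareShift hδ D
  have hα : IsProbabilityMeasure ((squareShift δ D).map (rest i)) :=
    Measure.isProbabilityMeasure_map (measurable_rest i).aemeasurable
  refine disintegrates_of_compProd hδ D hD i _ ?_
  rw [Measure.compProd_const]
  have hpair : IndepFun (rest i) (fun v : Profile n => v i) D := by
    have h := hind.indepFun_finset (Finset.univ.erase i) {i} (by simp)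
      (fun j => measurable_pi_apply j)
    have h1 : Measurable fun (b : ((Finset.univ.erase i : Finset (Fin n)) : Type) → Fin 2 → ℝ)
        (j : {j : Fin n // j ≠ i}) => b ⟨j.1, by simp [j.2]⟩ :=
      measurable_pi_lambda _ fun j => measurable_pi_apply _
    have h2 : Measurable fun b : (({i} : Finset (Fin n)) : Type) → Fin 2 → ℝ => b ⟨i, by simp⟩ :=
      measurable_pi_apply _
    have := h.comp h1 h2
    exact this
  have hprod := (indepFun_iff_map_prod_eq_prod_map_map (measurable_rest i).aemeasurable
    hev.aemeasurable).1 hpair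
  -- The perturbation of the other buyers alone: `rest i (shift v ε)` is by definition `S (rest i v,
  -- ε)`.
  set S : Others n i × Profile n → Others n i := fun p j => bump (p.1 j) (p.2 j.1) with hS
  have hSm : Measurable S := measurable_pi_lambda _ fun j => by
    have h : Measurable fun p : Others n i × Profile n => (p.1 j, p.2 j.1) := by fun_prop
    exact measurable_bump.comp h
  have h2 : Measurable fun p : Profile n × Profile n => (rest i (shift p.1 p.2), p.1 i) :=
    ((measurable_rest i).comp measurable_shift).prodMk
      ((measurable_pi_apply i).comp measurable_fst)
  have hb : Measurable fun v : Profile n => (rest i v, v i) := (measurable_rest i).prodMk hev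
  rw [← fst_map_rest_shift]
  set ν := (D.prod (noise n δ)).map fun p => (rest i (shift p.1 p.2), p.1 i) with hν
  have hrestm : IsProbabilityMeasure (D.map (rest i)) :=
    Measure.isProbabilityMeasure_map (measurable_rest i).aemeasurable
  have hfst : ν.fst = ((D.map (rest i)).prod (noise n δ)).map S := by
    refine Measure.ext_of_lintegral _ fun f hf => ?_
    have hfS : Measurable fun p => f (S p) := hf.comp hSm
    have hf1 : Measurable fun p : Profile n × Profile n => f (rest i (shift p.1 p.2)) :=
      hf.comp ((measurable_rest i).comp measurable_shift)
    have hf2 : Measurable fun b => ∫⁻ ε, f (S (b, ε)) ∂(noise n δ) := hfS.lintegral_prod_right'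
    have hf3 : Measurable fun p : Others n i × (Fin 2 → ℝ) => f p.1 := hf.comp measurable_fst
    rw [hν, Measure.fst, lintegral_map hf measurable_fst, lintegral_map hf3 h2,
      lintegral_map hf hSm, lintegral_prod _ hf1.aemeasurable, lintegral_prod _ hfS.aemeasurable,
      lintegral_map hf2 (measurable_rest i)]
    rfl
  refine Measure.ext_of_lintegral _ fun f hf => ?_
  have hm1 : Measurable fun q : (Others n i × (Fin 2 → ℝ)) × Profile n => f (S (q.1.1, q.2), q.1.2) :=
    hf.comp ((hSm.comp (measurable_fst.fst.prodMk measurable_snd)).prodMk measurable_fst.snd)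
  have hm2 : Measurable fun b => ∫⁻ u, f (b, u) ∂(D.map fun v => v i) :=
    hf.lintegral_prod_right'
  have hm3 : Measurable fun p => ∫⁻ u, f (S p, u) ∂(D.map fun v => v i) := hm2.comp hSm
  have hm4 : Measurable fun p : Profile n × Profile n => f (rest i (shift p.1 p.2), p.1 i) :=
    hf.comp h2
  have hm5 : Measurable fun q : Others n i × (Fin 2 → ℝ) =>
      ∫⁻ ε, f (S (q.1, ε), q.2) ∂(noise n δ) := hm1.lintegral_prod_right'
  rw [hfst, lintegral_prod _ hf.aemeasurable, lintegral_map hm2 hSm,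
    lintegral_prod _ hm3.aemeasurable, hν, lintegral_map hf h2, lintegral_prod _ hm4.aemeasurable]
  have e1 : ∫⁻ v, ∫⁻ ε, f (rest i (shift v ε), v i) ∂(noise n δ) ∂D =
      ∫⁻ q, ∫⁻ ε, f (S (q.1, ε), q.2) ∂(noise n δ) ∂(D.map fun v => (rest i v, v i)) := by
    rw [lintegral_map hm5 hb]
    rfl
  refine Eq.trans ?_ e1.symm
  rw [hprod, lintegral_prod _ hm5.aemeasurable]
  refine lintegral_congr fun b => ?_
  refine lintegral_lintegral_swap (f := fun ε u => f (S (b, ε), u)) ?_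
  exact (hf.comp ((hSm.comp (measurable_const.prodMk measurable_fst)).prodMk
    measurable_snd)).aemeasurable

/-! ### Measurable reserves and the revenue of Ronen's auction -/

theorem measurable_smooth_apply {Ω : Type*} [MeasurableSpace Ω] {δ : ℝ} (hδ : 0 < δ)
    (κ : Kernel Ω (Fin 2 → ℝ)) [IsMarkovKernel κ] {S : Set (Fin 2 → ℝ)} (hS : MeasurableSet S) :
    Measurable fun a => smooth δ (κ a) S := by
  have := isProbabilityMeasure_buyerNoise hδ
  have hm : Measurable (S.indicator (1 : (Fin 2 → ℝ) → ENNReal)) := measurable_one.indicator hS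
  simp_rw [← lintegral_indicator_one hS, fun a => lintegral_smooth δ (κ a) hδ _ hm]
  exact Measurable.lintegral_kernel (hm.comp measurable_bump).lintegral_prod_right'

theorem measurable_sup_range {Ω : Type*} [MeasurableSpace Ω] {f : ℕ → Ω → ENNReal}
    (hf : ∀ k, Measurable (f k)) (N : ℕ) :
    Measurable fun a => (Finset.range N).sup fun k => f k a := by
  induction N with
  | zero => simp
  | succ N ih =>
    simp_rw [Finset.range_add_one, Finset.sup_insert]
    exact (hf N).sup ih

/-- Among finitely many prices, one that is optimal can be chosen measurably. -/
theorem exists_measurable_price {Ω : Type*} [MeasurableSpace Ω] (K : Ω → Measure (Fin 2 → ℝ))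
    (hK : ∀ q : ℝ, Measurable fun a => K a {z | q ≤ ∑ j, z j}) (w : Ω → ℝ) (hw : Measurable w)
    (e : ℕ → ℚ) (N : ℕ) :
    ∃ R : Ω → ℝ, Measurable R ∧ ∀ a,
      ((Finset.range N).sup fun k =>
        if w a < e k then ENNReal.ofReal (e k) * K a {z | (e k : ℝ) ≤ ∑ j, z j} else 0) = 0 ∨
      w a < R a ∧ ((Finset.range N).sup fun k =>
        if w a < e k then ENNReal.ofReal (e k) * K a {z | (e k : ℝ) ≤ ∑ j, z j} else 0) =
          ENNReal.ofReal (R a) * K a {z | R a ≤ ∑ j, z j} := by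
  set val : ℕ → Ω → ENNReal := fun k a =>
    if w a < e k then ENNReal.ofReal (e k) * K a {z | (e k : ℝ) ≤ ∑ j, z j} else 0 with hval
  have hvm : ∀ k, Measurable (val k) := fun k =>
    Measurable.ite (measurableSet_lt hw measurable_const) ((hK _).const_mul _) measurable_const
  induction N with
  | zero => exact ⟨fun _ => 0, measurable_const, fun a => Or.inl (by simp)⟩
  | succ N ih =>
    obtain ⟨R, hR, h⟩ := ih
    have hsm : Measurable fun a => (Finset.range N).sup fun k => val k a :=
      measurable_sup_range hvm N
    -- The new price replaces the old one only when strictly better; its value is then positive,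
    -- which forces it to lie above `w a`.
    refine ⟨fun a => if ((Finset.range N).sup fun k => val k a) < val N a then (e N : ℝ) else R a,
      Measurable.ite (measurableSet_lt hsm (hvm N)) measurable_const hR, fun a => ?_⟩
    rw [Finset.range_add_one, Finset.sup_insert]
    by_cases hlt : ((Finset.range N).sup fun k => val k a) < val N a
    · right
      have hwN : w a < e N := by
        by_contra hne
        simp only [hval, if_neg hne] at hlt
        exact not_lt_zero hlt
      simp only [if_pos hlt]
      refine ⟨hwN, ?_⟩
      rw [sup_eq_left.2 hlt.le]
      exact if_pos hwN
    · simp only [if_neg hlt]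
      rw [sup_eq_right.2 (not_lt.1 hlt)]
      exact h a

theorem iSup_sup_range_eq_postedRevenue (K : Measure (Fin 2 → ℝ)) (w : ℝ) {e : ℕ → ℚ}
    (he : Function.Surjective e) :
    (⨆ N : ℕ, (Finset.range N).sup fun k =>
      if w < e k then ENNReal.ofReal (e k) * K {z | (e k : ℝ) ≤ ∑ j, z j} else 0) =
        postedRevenue K w := by
  rw [postedRevenue, ← he.iSup_comp]
  refine le_antisymm (iSup_le fun N => Finset.sup_le fun k _ => le_iSup_of_le k le_rfl)
    (iSup_le fun k => le_iSup_of_le (k + 1) ?_)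
  exact Finset.le_sup (f := fun k =>
    if w < e k then ENNReal.ofReal (e k) * K {z | (e k : ℝ) ≤ ∑ j, z j} else 0)
    (Finset.self_mem_range_succ k)

/-- The highest value for the grand bundle among the buyers other than `i`. -/
noncomputable def othersBid (i : Fin n) (a : Others n i) : ℝ := ⨆ j, ∑ k, a j k

theorem rivalBid_eq (v : Profile n) (i : Fin n) : rivalBid v i = othersBid i (rest i v) := rfl

theorem measurable_othersBid (i : Fin n) : Measurable (othersBid i) :=
  Measurable.iSup fun j => by fun_prop

theorem othersBid_nonneg {i : Fin n} {a : Others n i} (ha : 0 ≤ a) : 0 ≤ othersBid i a :=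
  Real.iSup_nonneg fun j => Finset.sum_nonneg fun k _ => ha j k

theorem bundle_le_rivalBid {i j : Fin n} (h : j ≠ i) (v : Profile n) :
    bundle v j ≤ rivalBid v i :=
  le_ciSup (f := fun j : {j : Fin n // j ≠ i} => bundle v j.1) (Set.finite_range _).bddAbove ⟨j, h⟩

theorem rivalBid_nonneg {v : Profile n} (hv : 0 ≤ v) (i : Fin n) : 0 ≤ rivalBid v i :=
  othersBid_nonneg fun j => hv j.1

theorem ReserveRule.pay_nonneg (ρ : ReserveRule n) {v : Profile n} (hv : 0 ≤ v) (i : Fin n) :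
    0 ≤ ρ.pay v i := by
  unfold ReserveRule.pay
  split_ifs
  · exact (rivalBid_nonneg hv i).trans (le_max_left _ _)
  · exact le_rfl

theorem measurable_bundle (i : Fin n) : Measurable fun v : Profile n => bundle v i := by
  unfold bundle; fun_prop

theorem ReserveRule.measurable_pay (ρ : ReserveRule n) (i : Fin n) :
    Measurable fun v => ρ.pay v i := by
  have hp : Measurable fun v => ρ.price v i :=
    ((measurable_othersBid i).comp (measurable_rest i)).max
      ((ρ.measurable_reserve i).comp (measurable_rest i))
  refine Measurable.ite ?_ hp measurable_const
  refine MeasurableSet.inter ?_ (MeasurableSet.inter ?_ ?_)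
  · refine (MeasurableSet.iInter fun j => measurableSet_le (measurable_bundle j)
      (measurable_bundle i)).congr ?_
    ext v
    exact Set.mem_iInter
  · refine (MeasurableSet.iInter fun j => MeasurableSet.iInter fun _ : j < i =>
      measurableSet_lt (measurable_bundle j) (measurable_bundle i)).congr ?_
    ext v
    exact Set.mem_iInter₂
  · exact measurableSet_le hp (measurable_bundle i)

/-- A buyer who reaches a reserve strictly above the competing bids is the unique highest bidder, so
ties play no role and the reserve is her price. This is the purpose of the strict inequality in
`postedRevenue`. -/
theorem ReserveRule.pay_glue_of_lt (ρ : ReserveRule n) (i : Fin n) (a : Others n i)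
    (z : Fin 2 → ℝ) (h1 : othersBid i a < ρ.reserve i a) (h2 : ρ.reserve i a ≤ ∑ j, z j) :
    ρ.pay (glue i z a) i = ρ.reserve i a := by
  have hb : bundle (glue i z a) i = ∑ j, z j := by rw [bundle, glue_self]
  have hr : rivalBid (glue i z a) i = othersBid i a := by rw [rivalBid_eq, rest_glue]
  have hp : ρ.price (glue i z a) i = ρ.reserve i a := by
    have : (fun j : {j : Fin n // j ≠ i} => glue i z a j.1) = a := rest_glue i z a
    rw [ReserveRule.price, hr, this, max_eq_right h1.le]
  have hlt : ∀ j, j ≠ i → bundle (glue i z a) j < bundle (glue i z a) i := fun j hj => by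
    have := bundle_le_rivalBid hj (glue i z a)
    rw [hr] at this
    rw [hb]; linarith
  rw [ReserveRule.pay, hp, if_pos]
  refine ⟨fun j => ?_, fun j hj => hlt j hj.ne, by rw [hb]; exact h2⟩
  rcases eq_or_ne j i with rfl | hj
  · exact le_rfl
  · exact (hlt j hj).le

theorem ae_nonneg_squareShift {δ : ℝ} (hδ : 0 < δ) (D : Measure (Profile n))
    [IsProbabilityMeasure D] (hD : ∀ᵐ v ∂D, 0 ≤ v) : ∀ᵐ v ∂(squareShift δ D), 0 ≤ v := by
  have := isProbabilityMeasure_noise (n := n) hδ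
  have := isProbabilityMeasure_buyerNoise hδ
  have hS : MeasurableSet {v : Profile n | 0 ≤ v} := measurableSet_Ici
  rw [squareShift, ae_map_iff measurable_shift.aemeasurable hS]
  have hε : ∀ᵐ ε ∂(noise n δ), ∀ i, 0 ≤ ε i := by
    refine ae_all_iff.2 fun i => ?_
    exact (Measure.tendsto_eval_ae_ae (μ := fun _ : Fin n => buyerNoise δ) (i := i)).eventually
      (ae_nonneg_buyerNoise hδ)
  have a1 : ∀ᵐ p ∂(D.prod (noise n δ)), 0 ≤ p.1 := Measure.quasiMeasurePreserving_fst.ae hD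
  have a2 : ∀ᵐ p ∂(D.prod (noise n δ)), ∀ i, 0 ≤ p.2 i :=
    Measure.quasiMeasurePreserving_snd.ae hε
  filter_upwards [a1, a2] with p h1 h2 i using (h1 i).trans (le_bump (h1 i) (h2 i))

theorem coe_ennreal_sum {ι : Type*} (s : Finset ι) (f : ι → ENNReal) :
    ((∑ i ∈ s, f i : ENNReal) : EReal) = ∑ i ∈ s, (f i : EReal) := by
  classical
  induction s using Finset.induction_on with
  | empty => simp
  | insert a s ha ih => rw [Finset.sum_insert ha, Finset.sum_insert ha, EReal.coe_ennreal_add, ih]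

theorem revenue_eq_of_nonneg (D : Measure (Profile n)) (pay : Profile n → Fin n → ℝ)
    (h : ∀ᵐ v ∂D, ∀ i, 0 ≤ pay v i) :
    revenue D pay = ((∑ i, ∫⁻ v, ENNReal.ofReal (pay v i) ∂D : ENNReal) : EReal) := by
  rw [revenue, coe_ennreal_sum]
  refine Finset.sum_congr rfl fun i _ => ?_
  have : ∫⁻ v, ENNReal.ofReal (-pay v i) ∂D = 0 := by
    rw [lintegral_congr_ae (g := fun _ => 0), lintegral_zero]
    filter_upwards [h] with v hv
    exact ENNReal.ofReal_of_nonpos (by linarith [hv i])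
  rw [expectation, this]
  simp

theorem sum_lintegral_pay_le_RonenRev {D : Measure (Profile n)} (hD : ∀ᵐ v ∂D, 0 ≤ v)
    (ρ : ReserveRule n) :
    ∑ i, ∫⁻ v, ENNReal.ofReal (ρ.pay v i) ∂D ≤ (RonenRev D).toENNReal := by
  have h : ((∑ i, ∫⁻ v, ENNReal.ofReal (ρ.pay v i) ∂D : ENNReal) : EReal) ≤ RonenRev D := by
    rw [← revenue_eq_of_nonneg D ρ.pay (by
      filter_upwards [hD] with v hv i using ρ.pay_nonneg hv i)]
    exact le_iSup (fun ρ : ReserveRule n => revenue D ρ.pay) ρ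
  rw [← EReal.coe_toENNReal ((EReal.coe_ennreal_nonneg _).trans h)] at h
  exact EReal.coe_ennreal_le_coe_ennreal_iff.1 h

/-- The rule without reserves. -/
def ReserveRule.zero (n : ℕ) : ReserveRule n := ⟨fun _ _ => 0, fun _ => measurable_const⟩

theorem RonenRev_nonneg {D : Measure (Profile n)} (hD : ∀ᵐ v ∂D, 0 ≤ v) : 0 ≤ RonenRev D := by
  refine le_trans ?_ (le_iSup (fun ρ : ReserveRule n => revenue D ρ.pay) (ReserveRule.zero n))
  rw [revenue_eq_of_nonneg]
  · exact EReal.coe_ennreal_nonneg _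
  · filter_upwards [hD] with v hv i using (ReserveRule.zero n).pay_nonneg hv i

/-- Ronen's auction extracts the optimal posted-price revenue above the highest competing bid from
every buyer. -/
theorem sum_lintegral_postedRevenue_le {δ : ℝ} (hδ : 0 < δ) (D : Measure (Profile n))
    [IsProbabilityMeasure D] (hD : ∀ᵐ v ∂D, 0 ≤ v)
    (κ : (i : Fin n) → Kernel (Others n i) (Fin 2 → ℝ)) [∀ i, IsMarkovKernel (κ i)]
    (hκ : ∀ i, Disintegrates δ D i (κ i)) :
    ∑ i, ∫⁻ a, postedRevenue (smooth δ (κ i a)) (othersBid i a) ∂((squareShift δ D).map (rest i)) ≤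
      (RonenRev (squareShift δ D)).toENNReal := by
  obtain ⟨e, he⟩ := exists_surjective_nat ℚ
  have hKm : ∀ i (q : ℝ), Measurable fun a => smooth δ (κ i a) {z | q ≤ ∑ j, z j} := fun i q =>
    measurable_smooth_apply hδ (κ i) (measurableSet_le_sum q)
  set m : (i : Fin n) → ℕ → Others n i → ENNReal := fun i N a => (Finset.range N).sup fun k =>
    if othersBid i a < e k then
      ENNReal.ofReal (e k) * smooth δ (κ i a) {z | (e k : ℝ) ≤ ∑ j, z j} else 0 with hm
  have hmono : ∀ i, Monotone (m i) := fun i N N' h a =>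
    Finset.sup_mono (Finset.range_mono h)
  have hmm : ∀ i N, Measurable (m i N) := by
    intro i N
    exact measurable_sup_range (fun k =>
      Measurable.ite (measurableSet_lt (measurable_othersBid i) measurable_const)
        ((hKm i _).const_mul _) measurable_const) N
  simp_rw [fun i a => (iSup_sup_range_eq_postedRevenue (smooth δ (κ i a)) (othersBid i a) he).symm]
  have e1 : ∀ i, ∫⁻ a, (⨆ N, m i N a) ∂((squareShift δ D).map (rest i)) =
      ⨆ N, ∫⁻ a, m i N a ∂((squareShift δ D).map (rest i)) := fun i =>
    lintegral_iSup (hmm i) (hmono i)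
  have e2 : ∀ i, Monotone fun N => ∫⁻ a, m i N a ∂((squareShift δ D).map (rest i)) :=
    fun i N N' h => lintegral_mono (hmono i h)
  -- Revenues from the first `N` prices increase with `N`, so one `N` can serve all buyers and a
  -- single reserve rule suffices for each `N`.
  rw [Finset.sum_congr rfl fun i _ => e1 i, ENNReal.finsetSum_iSup_of_monotone e2]
  refine iSup_le fun N => ?_
  choose R hR hRm using fun i => exists_measurable_price (fun a => smooth δ (κ i a)) (hKm i)
    (othersBid i) (measurable_othersBid i) e N
  refine le_trans (Finset.sum_le_sum fun i _ => ?_)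
    (sum_lintegral_pay_le_RonenRev (ae_nonneg_squareShift hδ D hD) ⟨R, hR⟩)
  rw [(hκ i).2 _ ((ReserveRule.mk R hR).measurable_pay i).ennreal_ofReal]
  refine lintegral_mono fun a => ?_
  rcases hRm i a with h0 | ⟨hlt, h⟩
  · exact h0.le.trans zero_le
  · refine h.le.trans ?_
    rw [← lintegral_indicator_const (measurableSet_le_sum _)]
    refine lintegral_mono fun z => ?_
    by_cases hz : z ∈ {z : Fin 2 → ℝ | R i a ≤ ∑ j, z j}
    · rw [Set.indicator_of_mem hz]
      simp only
      rw [ReserveRule.pay_glue_of_lt ⟨R, hR⟩ i a z hlt hz]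
    · rw [Set.indicator_of_notMem hz]
      exact zero_le

/-- The value that a feasible allocation gives to the buyers who are not highest bidders is at most
twice the second-price revenue for the grand bundle. -/
theorem sum_value_of_lower_bidders_le (v : Profile n) (hv : 0 ≤ v) (x : Fin n → Fin 2 → ℝ)
    (hx0 : ∀ i j, 0 ≤ x i j) (hx1 : ∀ j, ∑ i, x i j ≤ 1) :
    ∑ i, (if bundle v i < rivalBid v i then ENNReal.ofReal (∑ j, v i j * x i j) else 0) ≤
      2 * ∑ i, ENNReal.ofReal ((ReserveRule.zero n).pay v i) := by
  rcases isEmpty_or_nonempty (Fin n) with hn | hn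
  · simp
  obtain ⟨i₀, hi₀⟩ := Finite.exists_max (bundle v)
  -- The first of the highest bidders, as tie-breaking demands.
  obtain ⟨i, hi, hmin⟩ := WellFounded.has_min (wellFounded_lt (α := Fin n))
    {i | ∀ j, bundle v j ≤ bundle v i} ⟨i₀, hi₀⟩
  have hstrict : ∀ j < i, bundle v j < bundle v i := by
    intro j hj
    by_contra! h
    exact hmin j (fun k => (hi k).trans h) hj
  set w := rivalBid v i with hw
  have hw0 : 0 ≤ w := rivalBid_nonneg hv i
  have hwi : w ≤ bundle v i := Real.iSup_le (fun j => hi j.1) (Finset.sum_nonneg fun k _ => hv i k)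
  have hpay : (ReserveRule.zero n).pay v i = w := by
    have hp : (ReserveRule.zero n).price v i = w := max_eq_left hw0
    rw [ReserveRule.pay, hp, if_pos ⟨hi, hstrict, hwi⟩]
  have hterm : ∀ k, (if bundle v k < rivalBid v k then ENNReal.ofReal (∑ j, v k j * x k j) else 0) ≤
      ENNReal.ofReal (∑ j, w * x k j) := by
    intro k
    split_ifs with h
    · refine ENNReal.ofReal_le_ofReal (Finset.sum_le_sum fun j _ => ?_)
      refine mul_le_mul_of_nonneg_right ?_ (hx0 k j)
      -- A buyer strictly below her competing bid is not the winner `i`, so her bundle value, and a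
      -- fortiori her value for one item, is at most the price `w` that `i` pays.
      have hki : k ≠ i := by
        rintro rfl
        exact absurd h (not_lt.2 hwi)
      exact (Finset.single_le_sum (f := v k) (fun j _ => hv k j) (Finset.mem_univ j)).trans
        (bundle_le_rivalBid hki v)
    · exact zero_le
  calc _ ≤ ∑ k, ENNReal.ofReal (∑ j, w * x k j) := Finset.sum_le_sum fun k _ => hterm k
    _ = ENNReal.ofReal (∑ k, ∑ j, w * x k j) :=
        (ENNReal.ofReal_sum_of_nonneg fun k _ =>
          Finset.sum_nonneg fun j _ => mul_nonneg hw0 (hx0 k j)).symm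
    _ ≤ ENNReal.ofReal (2 * w) := by
        refine ENNReal.ofReal_le_ofReal ?_
        rw [Finset.sum_comm]
        simp_rw [← Finset.mul_sum]
        rw [Fin.sum_univ_two]
        nlinarith [hx1 0, hx1 1]
    _ = 2 * ENNReal.ofReal ((ReserveRule.zero n).pay v i) := by
        rw [hpay, ENNReal.ofReal_mul zero_le_two]; simp
    _ ≤ _ := by
        gcongr
        exact Finset.single_le_sum (f := fun i => ENNReal.ofReal ((ReserveRule.zero n).pay v i))
          (fun _ _ => zero_le) (Finset.mem_univ i)

/-! ### From one buyer to truthful mechanisms -/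

namespace Mechanism

variable (M : Mechanism n)

theorem alloc_le_one {v : Profile n} (hv : 0 ≤ v) (i : Fin n) (j : Fin 2) : M.alloc v i j ≤ 1 :=
  (Finset.single_le_sum (f := fun i => M.alloc v i j) (fun i _ => M.alloc_nonneg v hv i j)
    (Finset.mem_univ i)).trans (M.alloc_feasible v hv j)

theorem measurable_alloc_glue (i : Fin n) :
    Measurable (Function.uncurry fun (z : Fin 2 → ℝ) (a : Others n i) => M.alloc (glue i z a) i) :=
  (measurable_pi_apply i).comp (M.measurable_alloc.comp (measurable_glue i))

theorem measurable_pay_glue (i : Fin n) :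
    Measurable (Function.uncurry fun (z : Fin 2 → ℝ) (a : Others n i) => M.pay (glue i z a) i) :=
  (measurable_pi_apply i).comp (M.measurable_pay.comp (measurable_glue i))

/-- The value that buyer `i` obtains when she is not a highest bidder. -/
noncomputable def lowValue (i : Fin n) (v : Profile n) : ENNReal :=
  if bundle v i < rivalBid v i then ENNReal.ofReal (∑ j, v i j * M.alloc v i j) else 0

theorem measurable_lowValue (i : Fin n) : Measurable (M.lowValue i) := by
  refine Measurable.ite (measurableSet_lt (measurable_bundle i)
    ((measurable_othersBid i).comp (measurable_rest i))) ?_ measurable_const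
  refine Measurable.ennreal_ofReal (Finset.measurable_fun_sum _ fun j _ => Measurable.mul ?_ ?_)
  · fun_prop
  · exact (measurable_pi_apply j).comp ((measurable_pi_apply i).comp M.measurable_alloc)

theorem lowValue_glue (i : Fin n) (z : Fin 2 → ℝ) (a : Others n i) :
    M.lowValue i (glue i z a) = if ∑ j, z j < othersBid i a
      then ENNReal.ofReal (∑ j, z j * M.alloc (glue i z a) i j) else 0 := by
  rw [lowValue, bundle, rivalBid_eq, rest_glue, glue_self]

theorem sum_lintegral_lowValue_le {D : Measure (Profile n)} (hD : ∀ᵐ v ∂D, 0 ≤ v) :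
    ∑ i, ∫⁻ v, M.lowValue i v ∂D ≤ 2 * (RonenRev D).toENNReal := by
  rw [← lintegral_finsetSum _ fun i _ => M.measurable_lowValue i]
  refine le_trans ?_ (mul_le_mul_right (sum_lintegral_pay_le_RonenRev hD (ReserveRule.zero n)) 2)
  have hm : ∀ i, Measurable fun v => ENNReal.ofReal ((ReserveRule.zero n).pay v i) := fun i =>
    ((ReserveRule.zero n).measurable_pay i).ennreal_ofReal
  rw [← lintegral_finsetSum _ fun i _ => hm i,
    ← lintegral_const_mul _ (Finset.measurable_fun_sum _ fun i _ => hm i)]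
  refine lintegral_mono_ae ?_
  filter_upwards [hD] with v hv
  exact sum_value_of_lower_bidders_le v hv (M.alloc v) (M.alloc_nonneg v hv)
    (M.alloc_feasible v hv)

/-- The revenue from buyer `i` with perturbed values, when the mechanism is incentive compatible and
individually rational in expectation over a law `μ` of the reports of the others. -/
theorem lintegral_pay_le {δ : ℝ} (hδ : 0 < δ) (i : Fin n) (μ : Measure (Others n i))
    [IsProbabilityMeasure μ] (hμ : ∀ᵐ a ∂μ, 0 ≤ a) (κ : Measure (Fin 2 → ℝ))
    [IsProbabilityMeasure κ] (hκ : ∀ᵐ v ∂κ, 0 ≤ v)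
    (hIC : ∀ z y, 0 ≤ z → 0 ≤ y →
      ∫ a, ∑ j, z j * M.alloc (glue i y a) i j ∂μ - ∫ a, M.pay (glue i y a) i ∂μ ≤
        ∫ a, ∑ j, z j * M.alloc (glue i z a) i j ∂μ - ∫ a, M.pay (glue i z a) i ∂μ)
    (hIR : ∀ z, 0 ≤ z →
      ∫ a, M.pay (glue i z a) i ∂μ ≤ ∫ a, ∑ j, z j * M.alloc (glue i z a) i j ∂μ) :
    ∫⁻ z, ENNReal.ofReal (∫ a, M.pay (glue i z a) i ∂μ) ∂(smooth δ κ) ≤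
      (∫⁻ a, ∫⁻ z, M.lowValue i (glue i z a) ∂(smooth δ κ) ∂μ) +
        ENNReal.ofReal (6 * (1 + δ) ^ 2 / δ) *
          ∫⁻ a, postedRevenue (smooth δ κ) (othersBid i a) ∂μ := by
  simp_rw [lowValue_glue]
  refine lintegral_buyer_payment_le μ hδ κ hκ (fun z a => M.alloc (glue i z a) i)
    (M.measurable_alloc_glue i) (fun z hz => ?_) (fun z => ∫ a, M.pay (glue i z a) i ∂μ) ?_ hIC hIR
    (othersBid i) (measurable_othersBid i) ?_
  · filter_upwards [hμ] with a ha j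
    exact ⟨M.alloc_nonneg _ (glue_nonneg hz ha) i j, M.alloc_le_one (glue_nonneg hz ha) i j⟩
  · exact (M.measurable_pay_glue i).stronglyMeasurable.integral_prod_right.measurable
  · filter_upwards [hμ] with a ha using othersBid_nonneg ha

theorem ae_rest_nonneg {D : Measure (Profile n)} (hD : ∀ᵐ v ∂D, 0 ≤ v) (i : Fin n) :
    ∀ᵐ a ∂(D.map (rest i)), 0 ≤ a := by
  have hS : MeasurableSet {a : Others n i | 0 ≤ a} := measurableSet_Ici
  rw [ae_map_iff (measurable_rest i).aemeasurable hS]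
  filter_upwards [hD] with v hv j using hv j.1

/-- The constraints hold for each profile of other reports, so the one-buyer bound applies with the
Dirac mass there, against the conditional law of her values; then integrate. -/
theorem lintegral_pay_le_of_DSIC {δ : ℝ} (hδ : 0 < δ) (D : Measure (Profile n))
    [IsProbabilityMeasure D] (hD : ∀ᵐ v ∂D, 0 ≤ v) (hM : M.DSIC) (hM' : M.ExPostIR) (i : Fin n)
    (κ : Kernel (Others n i) (Fin 2 → ℝ)) [IsMarkovKernel κ] (hκ : Disintegrates δ D i κ) :
    ∫⁻ v, ENNReal.ofReal (M.pay v i) ∂(squareShift δ D) ≤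
      (∫⁻ v, M.lowValue i v ∂(squareShift δ D)) + ENNReal.ofReal (6 * (1 + δ) ^ 2 / δ) *
        ∫⁻ a, postedRevenue (smooth δ (κ a)) (othersBid i a) ∂((squareShift δ D).map (rest i)) := by
  have hα0 : ∀ᵐ a ∂((squareShift δ D).map (rest i)), 0 ≤ a :=
    ae_rest_nonneg (ae_nonneg_squareShift hδ D hD) i
  have hpp : Measurable fun v => M.pay v i := (measurable_pi_apply i).comp M.measurable_pay
  have hVm : Measurable fun a => ∫⁻ z, M.lowValue i (glue i z a) ∂(smooth δ (κ a)) := by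
    have := isProbabilityMeasure_buyerNoise hδ
    have hz : ∀ a, Measurable fun z => M.lowValue i (glue i z a) := fun a =>
      (M.measurable_lowValue i).comp ((measurable_glue i).comp measurable_prodMk_right)
    simp_rw [fun a => lintegral_smooth δ (κ a) hδ _ (hz a)]
    have h3 : Measurable fun q : (Others n i × (Fin 2 → ℝ)) × (Fin 2 → ℝ) =>
        M.lowValue i (glue i (bump q.1.2 q.2) q.1.1) :=
      (M.measurable_lowValue i).comp ((measurable_glue i).comp ((measurable_bump.comp
        (measurable_fst.snd.prodMk measurable_snd)).prodMk measurable_fst.fst))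
    exact Measurable.lintegral_kernel_prod_right h3.lintegral_prod_right'
  rw [hκ.2 _ hpp.ennreal_ofReal, hκ.2 _ (M.measurable_lowValue i),
    ← lintegral_const_mul' _ _ ENNReal.ofReal_ne_top, ← lintegral_add_left hVm]
  refine lintegral_mono_ae ?_
  filter_upwards [hα0, hκ.1] with a ha hκa
  have key := M.lintegral_pay_le hδ i (Measure.dirac a) (ae_dirac_eq (a := a) ▸ ha) (κ a) hκa
    (fun z y hz hy => by
      have := hM (glue i z a) (glue_nonneg hz ha) i y hy
      rw [update_glue, glue_self] at this
      simpa only [integral_dirac, utility] using this)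
    (fun z hz => by
      have := hM' (glue i z a) (glue_nonneg hz ha) i
      rw [utility, glue_self] at this
      simp only [integral_dirac]
      linarith)
  simpa only [integral_dirac, lintegral_dirac] using key

/-- Here the state is the random profile of other reports. Only interim payments are controlled, so
the negative parts of the actual payments are kept on the right-hand side. -/
theorem lintegral_pay_le_of_BIC {δ : ℝ} (hδ : 0 < δ) (D : Measure (Profile n))
    [IsProbabilityMeasure D] (hD : ∀ᵐ v ∂D, 0 ≤ v) (hM : M.BIC (squareShift δ D))
    (hM' : M.InterimIR (squareShift δ D)) (i : Fin n) (κ : Measure (Fin 2 → ℝ))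
    [IsProbabilityMeasure κ] (hκ : Disintegrates δ D i (Kernel.const _ κ)) :
    ∫⁻ v, ENNReal.ofReal (M.pay v i) ∂(squareShift δ D) ≤
      ((∫⁻ v, M.lowValue i v ∂(squareShift δ D)) + ENNReal.ofReal (6 * (1 + δ) ^ 2 / δ) *
        ∫⁻ a, postedRevenue (smooth δ κ) (othersBid i a) ∂((squareShift δ D).map (rest i))) +
        ∫⁻ v, ENNReal.ofReal (-M.pay v i) ∂(squareShift δ D) := by
  have := isProbabilityMeasure_squareShift hδ D
  have := isProbabilityMeasure_smooth hδ κ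
  set α := (squareShift δ D).map (rest i) with hα
  have hαp : IsProbabilityMeasure α :=
    Measure.isProbabilityMeasure_map (measurable_rest i).aemeasurable
  have hα0 : ∀ᵐ a ∂α, 0 ≤ a := ae_rest_nonneg (ae_nonneg_squareShift hδ D hD) i
  have hκ0 : ∀ᵐ v ∂κ, 0 ≤ v := by
    obtain ⟨a, ha⟩ := hκ.1.exists
    exact ha
  have hpm : ∀ z, Measurable fun a => M.pay (glue i z a) i := fun z =>
    (M.measurable_pay_glue i).of_uncurry_left
  have ham : ∀ z, Measurable fun a => M.alloc (glue i z a) i := fun z =>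
    (M.measurable_alloc_glue i).of_uncurry_left
  have hpi : ∀ z, 0 ≤ z → Integrable (fun a => M.pay (glue i z a) i) α := by
    intro z hz
    have h := hM.1 i z hz
    simp_rw [update_eq_glue] at h
    exact (integrable_map_measure (hpm z).aestronglyMeasurable
      (measurable_rest i).aemeasurable).2 h
  have hsm : ∀ z y : Fin 2 → ℝ, Measurable fun a => ∑ j, z j * M.alloc (glue i y a) i j := fun z y =>
    Finset.measurable_fun_sum _ fun j _ => ((measurable_pi_apply j).comp (ham y)).const_mul _
  have hsi : ∀ z y : Fin 2 → ℝ, 0 ≤ y → Integrable (fun a => ∑ j, z j * M.alloc (glue i y a) i j) α := by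
    intro z y hy
    refine integrable_finsetSum _ fun j _ => Integrable.const_mul ?_ _
    refine Integrable.of_bound ((measurable_pi_apply j).comp (ham y)).aestronglyMeasurable 1 ?_
    filter_upwards [hα0] with a ha
    have hg := glue_nonneg hy ha
    simp only [Real.norm_eq_abs]
    rw [abs_of_nonneg (M.alloc_nonneg _ hg i j)]
    exact M.alloc_le_one hg i j
  have hint : ∀ z y : Fin 2 → ℝ, 0 ≤ y → M.interimUtility (squareShift δ D) i z y =
      ∫ a, ∑ j, z j * M.alloc (glue i y a) i j ∂α - ∫ a, M.pay (glue i y a) i ∂α := by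
    intro z y hy
    have hd : Measurable fun a => ∑ j, z j * M.alloc (glue i y a) i j - M.pay (glue i y a) i :=
      (hsm z y).sub (hpm y)
    rw [← integral_sub (hsi z y hy) (hpi y hy), hα,
      integral_map (measurable_rest i).aemeasurable hd.aestronglyMeasurable]
    simp only [interimUtility, utility, update_eq_glue]
  have key := M.lintegral_pay_le hδ i α hα0 κ hκ0
    (fun z y hz hy => by
      rw [← hint z y hy, ← hint z z hz]
      exact hM.2 i z y hz hy)
    (fun z hz => by
      have := hM' i z hz
      rw [hint z z hz] at this
      linarith)
  have hlow := hκ.2 _ (M.measurable_lowValue i)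
  have hpp : Measurable fun v => M.pay v i := (measurable_pi_apply i).comp M.measurable_pay
  have hpos := hκ.2 _ hpp.ennreal_ofReal
  have hneg := hκ.2 (fun v => ENNReal.ofReal (-M.pay v i)) hpp.neg.ennreal_ofReal
  simp only [Kernel.const_apply, ← hα] at hlow hpos hneg
  rw [hlow, hpos, hneg]
  refine le_trans ?_ (add_le_add key le_rfl)
  have hposm := (M.measurable_pay_glue i).ennreal_ofReal
  have hnegm := (M.measurable_pay_glue i).neg.ennreal_ofReal
  have s1 : ∫⁻ a, ∫⁻ z, ENNReal.ofReal (M.pay (glue i z a) i) ∂(smooth δ κ) ∂α =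
      ∫⁻ z, ∫⁻ a, ENNReal.ofReal (M.pay (glue i z a) i) ∂α ∂(smooth δ κ) :=
    (lintegral_lintegral_swap hposm.aemeasurable).symm
  have s2 : ∫⁻ a, ∫⁻ z, ENNReal.ofReal (-M.pay (glue i z a) i) ∂(smooth δ κ) ∂α =
      ∫⁻ z, ∫⁻ a, ENNReal.ofReal (-M.pay (glue i z a) i) ∂α ∂(smooth δ κ) :=
    (lintegral_lintegral_swap hnegm.aemeasurable).symm
  have hnegm' : Measurable fun z => ∫⁻ a, ENNReal.ofReal (-M.pay (glue i z a) i) ∂α :=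
    hnegm.lintegral_prod_right'
  rw [s1, s2, ← lintegral_add_right _ hnegm']
  refine lintegral_mono_ae ?_
  have hz0 : ∀ᵐ z ∂(smooth δ κ), 0 ≤ z := ae_nonneg_smooth hδ κ hκ0
  filter_upwards [hz0] with z hz
  have hi := hpi z hz
  have h := integral_eq_lintegral_pos_part_sub_lintegral_neg_part hi
  have f1 : ∫⁻ a, ENNReal.ofReal (M.pay (glue i z a) i) ∂α ≠ ⊤ := hi.lintegral_lt_top.ne
  have f2 : ∫⁻ a, ENNReal.ofReal (-M.pay (glue i z a) i) ∂α ≠ ⊤ := hi.neg.lintegral_lt_top.ne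
  -- Both parts of the interim payment are finite, so the mean of the positive part is at most the
  -- positive part of the interim payment plus the mean of the negative part.
  rw [h, ENNReal.ofReal_sub _ ENNReal.toReal_nonneg, ENNReal.ofReal_toReal f1,
    ENNReal.ofReal_toReal f2]
  exact le_tsub_add

end Mechanism

/-! ### The constant and the conclusion -/

/-- Both constants are compared with `9 * (1 + δ) ^ 2 / δ`, using `log (1 + δ) ≥ δ / (1 + δ)` and
`√2 ≥ 1`. -/
theorem const_le_approximationFactor {δ : ℝ} (hδ : 0 < δ) :
    2 + 6 * (1 + δ) ^ 2 / δ ≤ 9 * √2 * (1 + δ) ^ 3 * Real.log (1 + δ) / δ ^ 2 := by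
  have h1 : 0 < 1 + δ := by linarith
  have hlog : δ / (1 + δ) ≤ Real.log (1 + δ) := by
    have := Real.one_sub_inv_le_log_of_pos h1
    have e : 1 - (1 + δ)⁻¹ = δ / (1 + δ) := by field_simp; ring
    rwa [e] at this
  have hs : 1 ≤ √2 := Real.one_le_sqrt.2 (by norm_num)
  calc 2 + 6 * (1 + δ) ^ 2 / δ ≤ 9 * (1 + δ) ^ 2 / δ := by
        rw [← sub_nonneg]
        have : 9 * (1 + δ) ^ 2 / δ - (2 + 6 * (1 + δ) ^ 2 / δ) = (3 + 4 * δ + 3 * δ ^ 2) / δ := by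
          field_simp; ring
        rw [this]; positivity
    _ = 9 * 1 * (1 + δ) ^ 3 * (δ / (1 + δ)) / δ ^ 2 := by field_simp
    _ ≤ _ := by gcongr

theorem isBigO_approximationFactor :
    (fun η : ℝ => 9 * √2 * (1 + η) ^ 3 * Real.log (1 + η) / η ^ 2) =O[𝓝[>] 0]
      (fun η : ℝ => 1 / η) := by
  refine IsBigO.of_bound (9 * √2 * 2 ^ 3) ?_
  filter_upwards [Ioo_mem_nhdsGT (zero_lt_one' ℝ)] with η hη
  obtain ⟨h0, h1⟩ := hη
  have hlog0 : 0 ≤ Real.log (1 + η) := Real.log_nonneg (by linarith)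
  have hlog : Real.log (1 + η) ≤ η := by
    have := Real.log_le_sub_one_of_pos (show 0 < 1 + η by linarith)
    linarith
  rw [Real.norm_of_nonneg (by positivity), Real.norm_of_nonneg (by positivity)]
  calc 9 * √2 * (1 + η) ^ 3 * Real.log (1 + η) / η ^ 2
      ≤ 9 * √2 * 2 ^ 3 * η / η ^ 2 := by
        gcongr
        linarith
    _ = 9 * √2 * 2 ^ 3 * (1 / η) := by field_simp

/-- The additive form of the hypothesis needs no finiteness: if the negative part has infinite
integral, the expectation is `⊥`. -/
theorem expectation_le (D : Measure (Profile n)) (f : Profile n → ℝ) (X : ENNReal)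
    (h : ∫⁻ v, ENNReal.ofReal (f v) ∂D ≤ X + ∫⁻ v, ENNReal.ofReal (-f v) ∂D) :
    expectation D f ≤ X := by
  refine EReal.sub_le_of_le_add ?_
  rw [← EReal.coe_ennreal_add]
  exact EReal.coe_ennreal_le_coe_ennreal_iff.2 h

theorem revenue_le_of_expectation_le {δ : ℝ} (hδ : 0 < δ) (D : Measure (Profile n))
    [IsProbabilityMeasure D] (hD : ∀ᵐ v ∂D, 0 ≤ v)
    (κ : (i : Fin n) → Kernel (Others n i) (Fin 2 → ℝ)) [∀ i, IsMarkovKernel (κ i)]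
    (hκ : ∀ i, Disintegrates δ D i (κ i)) (M : Mechanism n)
    (h : ∀ i, expectation (squareShift δ D) (fun v => M.pay v i) ≤
      (((∫⁻ v, M.lowValue i v ∂(squareShift δ D)) + ENNReal.ofReal (6 * (1 + δ) ^ 2 / δ) *
        ∫⁻ a, postedRevenue (smooth δ (κ i a)) (othersBid i a)
          ∂((squareShift δ D).map (rest i)) : ENNReal) : EReal)) :
    revenue (squareShift δ D) M.pay ≤
      ((9 * √2 * (1 + δ) ^ 3 * Real.log (1 + δ) / δ ^ 2 : ℝ) : EReal) *
        RonenRev (squareShift δ D) := by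
  have hc := const_le_approximationFactor hδ
  have hD' := ae_nonneg_squareShift hδ D hD
  have h6 : 0 ≤ 6 * (1 + δ) ^ 2 / δ := by positivity
  refine (Finset.sum_le_sum fun i _ => h i).trans ?_
  rw [← coe_ennreal_sum, ← EReal.coe_toENNReal (RonenRev_nonneg hD'),
    ← max_eq_left (show 0 ≤ 9 * √2 * (1 + δ) ^ 3 * Real.log (1 + δ) / δ ^ 2 by linarith),
    ← EReal.coe_ennreal_ofReal, ← EReal.coe_ennreal_mul, EReal.coe_ennreal_le_coe_ennreal_iff,
    Finset.sum_add_distrib, ← Finset.mul_sum]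
  calc _ ≤ 2 * (RonenRev (squareShift δ D)).toENNReal +
        ENNReal.ofReal (6 * (1 + δ) ^ 2 / δ) * (RonenRev (squareShift δ D)).toENNReal :=
        add_le_add (M.sum_lintegral_lowValue_le hD')
          (mul_le_mul_right (sum_lintegral_postedRevenue_le hδ D hD κ hκ) _)
    _ = ENNReal.ofReal (2 + 6 * (1 + δ) ^ 2 / δ) * (RonenRev (squareShift δ D)).toENNReal := by
        rw [ENNReal.ofReal_add zero_le_two h6, add_mul]; simp
    _ ≤ _ := by gcongr

end SmoothedAuction

theorem mainTheorem5 (n : ℕ) (δ : ℝ) (hδ : 0 < δ)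
    (D : Measure (SmoothedAuction.Profile n)) [IsProbabilityMeasure D]
    (hD : ∀ᵐ v ∂D, 0 ≤ v) :
    SmoothedAuction.DRev (SmoothedAuction.squareShift δ D) ≤
        ((9 * √2 * (1 + δ) ^ 3 * Real.log (1 + δ) / δ ^ 2 : ℝ) : EReal) *
          SmoothedAuction.RonenRev (SmoothedAuction.squareShift δ D) ∧
      (iIndepFun (fun (i : Fin n) (v : SmoothedAuction.Profile n) => v i) D →
        SmoothedAuction.BICRev (SmoothedAuction.squareShift δ D) ≤
          ((9 * √2 * (1 + δ) ^ 3 * Real.log (1 + δ) / δ ^ 2 : ℝ) : EReal) *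
            SmoothedAuction.RonenRev (SmoothedAuction.squareShift δ D)) ∧
      (fun η : ℝ => 9 * √2 * (1 + η) ^ 3 * Real.log (1 + η) / η ^ 2) =O[𝓝[>] 0]
        (fun η : ℝ => 1 / η) := by
  open SmoothedAuction in
  refine ⟨iSup_le fun ⟨M, hM, hM'⟩ => ?_, fun hind => iSup_le fun ⟨M, hM, hM'⟩ => ?_,
    isBigO_approximationFactor⟩
  · choose κ hκm hκ using fun i => exists_disintegrates hδ D hD i
    exact revenue_le_of_expectation_le hδ D hD κ hκ M fun i => expectation_le _ _ _
      ((M.lintegral_pay_le_of_DSIC hδ D hD hM hM' i (κ i) (hκ i)).trans le_self_add)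
  · have hp : ∀ i : Fin n, IsProbabilityMeasure (D.map fun v => v i) := fun i =>
      Measure.isProbabilityMeasure_map (measurable_pi_apply i).aemeasurable
    have hκm : ∀ i : Fin n, IsMarkovKernel (Kernel.const (Others n i) (D.map fun v => v i)) :=
      fun i => inferInstance
    have hκ := disintegrates_const hδ D hD hind
    refine revenue_le_of_expectation_le hδ D hD _ hκ M fun i => expectation_le _ _ _ ?_
    exact M.lintegral_pay_le_of_BIC hδ D hD hM hM' i _ (hκ i)
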